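/- Let $V$ be a discrete valuation ring with quotient field $F$, let $K/F$ be a finite Galois extension with group $G$, and let $S$ be the integral closure of $V$ in $K$; assume that $S$ is unramified over $V$ (that is, every maximal ideal of $S$ has ramification index $1$ and separable residue field extension over $V$). Let $f\colon G\times G\to S\setminus\{0\}$ be a normalized two-cocycle, i.e. $f(\sigma\tau,\rho)f(\sigma,\tau)=\sigma(f(\tau,\rho))f(\sigma,\tau\rho)$ and $f(1,\sigma)=f(\sigma,1)=1$ for all $\sigma,\tau,\rho\in G$. Let $\Sigma_f=\sum_{\sigma\in G}Kx_\sigma=(K/F,G,f)$ be the crossed-product $F$-algebra with $K$-basis $(x_\sigma)_{\sigma\in G}$, identity $x_1$ and multiplication given by $x_\sigma a=\sigma(a)x_\sigma$ for $a\in K$ and $x_\sigma x_\tau=f(\sigma,\tau)x_{\sigma\tau}$, and let $A_f=\sum_{\sigma\in G}Sx_\sigma\subseteq\Sigma_f$, a $V$-order in $\Sigma_f$. A ring is called hereditary if all its left ideals and all its right ideals are projective; an order is called hereditary if it is a hereditary ring. Suppose that $A_f$ is hereditary. Let $L$ be any intermediate field of $K/F$, put $G_L=\mathrm{Gal}(K/L)$,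 let $U$ be any valuation ring of $L$ lying over $V$ (i.e. $U\cap F=V$), let $T$ be the integral closure of $U$ in $K$, and let $f_{L,U}\colon G_L\times G_L\to T\setminus\{0\}$ be the two-cocycle obtained by restricting $f$ to $G_L\times G_L$ and using the inclusion $S\subseteq T$. Then $A_{f_{L,U}}=\sum_{\tau\in G_L}Tx_\tau$ is a hereditary $U$-order in $\Sigma_{f_{L,U}}=\sum_{\tau\in G_L}Kx_\tau=(K/L,G_L,f_{L,U})$; that is, it is a $U$-subalgebra of $\Sigma_{f_{L,U}}$ which is finitely generated as a $U$-module, spans $\Sigma_{f_{L,U}}$ over $L$, and is a hereditary ring. -/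

import Mathlib

open groupCohomology

/-- A normalized two-cocycle `f ∈ Z²(G, U(K))` of a field extension `K/E` with `G = Gal(K/E)`:
a two-cocycle with values in the units of `K` such that `f(1, σ) = f(σ, 1) = 1`. -/
structure NormalizedTwoCocycle (E K : Type*) [Field E] [Field K] [Algebra E K] where
  /-- the underlying function -/
  toFun : Gal(K/E) × Gal(K/E) → Kˣ
  isMulCocycle₂ : IsMulCocycle₂ toFun
  map_one_left : ∀ σ : Gal(K/E), toFun (1, σ) = 1
  map_one_right : ∀ σ : Gal(K/E), toFun (σ, 1) = 1

namespace NormalizedTwoCocycle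

variable {E K : Type*} [Field E] [Field K] [Algebra E K]

/-- The value `f(σ, τ)`, as an element of `K`. -/
def val (f : NormalizedTwoCocycle E K) (σ τ : Gal(K/E)) : K := (f.toFun (σ, τ) : K)

theorem val_one_left (f : NormalizedTwoCocycle E K) (σ : Gal(K/E)) : f.val 1 σ = 1 := by
  simp [val, f.map_one_left]

theorem val_one_right (f : NormalizedTwoCocycle E K) (σ : Gal(K/E)) : f.val σ 1 = 1 := by
  simp [val, f.map_one_right]

theorem val_cocycle (f : NormalizedTwoCocycle E K) (σ τ ρ : Gal(K/E)) :
    f.val (σ * τ) ρ * f.val σ τ = σ (f.val τ ρ) * f.val σ (τ * ρ) :=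
  congrArg Units.val (f.isMulCocycle₂ σ τ ρ)

/-- The two-cocycle `f` takes its values in the integral closure of `V` in `K`
(they are nonzero because they are units of `K`). -/
def IsIntegralOver (f : NormalizedTwoCocycle E K) (V : ValuationSubring E) : Prop :=
  ∀ σ τ : Gal(K/E), f.val σ τ ∈ integralClosure V K

/-- The restriction of `f` to `G_L × G_L`, where `G_L = Gal(K/L)` is regarded as a subgroup of
`G = Gal(K/E)`. -/
def restrict (f : NormalizedTwoCocycle E K) (L : IntermediateField E K) :
    NormalizedTwoCocycle L K where
  toFun p := f.toFun (p.1.restrictScalars E, p.2.restrictScalars E)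
  isMulCocycle₂ σ τ ρ :=
    f.isMulCocycle₂ (σ.restrictScalars E) (τ.restrictScalars E) (ρ.restrictScalars E)
  map_one_left σ := f.map_one_left (σ.restrictScalars E)
  map_one_right σ := f.map_one_right (σ.restrictScalars E)

end NormalizedTwoCocycle

/-- The crossed product `Σ_f = ∑_{σ ∈ G} K x_σ = (K/E, G, f)`, `G = Gal(K/E)`: the left `K`-vector
space with basis `(x_σ)`, an element being given by its coordinates. -/
def CrossedProduct {E K : Type*} [Field E] [Field K] [Algebra E K]
    (_f : NormalizedTwoCocycle E K) : Type _ :=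
  Gal(K/E) →₀ K

namespace CrossedProduct

noncomputable section

variable {E K : Type*} [Field E] [Field K] [Algebra E K] {f : NormalizedTwoCocycle E K}

instance : AddCommGroup (CrossedProduct f) := inferInstanceAs (AddCommGroup (Gal(K/E) →₀ K))

/-- The family of coordinates of an element. -/
def toFinsupp : CrossedProduct f ≃+ (Gal(K/E) →₀ K) := AddEquiv.refl _

/-- The coordinate of `x` at the basis element `x_σ`. -/
def coeff (x : CrossedProduct f) (σ : Gal(K/E)) : K := toFinsupp x σ

/-- The element `a x_σ`. -/
def single (f : NormalizedTwoCocycle E K) (σ : Gal(K/E)) (a : K) : CrossedProduct f :=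
  toFinsupp.symm (Finsupp.single σ a)

/-- The multiplication: `(a x_σ) (b x_τ) = a σ(b) f(σ, τ) x_{στ}`, extended biadditively. -/
instance : Mul (CrossedProduct f) where
  mul x y := (toFinsupp x).sum fun σ a ↦ (toFinsupp y).sum fun τ b ↦
    single f (σ * τ) (a * σ b * f.val σ τ)

/-- The identity is `x_1`. -/
instance : One (CrossedProduct f) where
  one := single f 1 1

theorem one_def : (1 : CrossedProduct f) = single f 1 1 := rfl

theorem mul_def (x y : CrossedProduct f) :
    x * y = (toFinsupp x).sum fun σ a ↦ (toFinsupp y).sum fun τ b ↦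
      single f (σ * τ) (a * σ b * f.val σ τ) := rfl

theorem single_zero (σ : Gal(K/E)) : single f σ 0 = 0 := Finsupp.single_zero σ

theorem single_add (σ : Gal(K/E)) (a b : K) :
    single f σ (a + b) = single f σ a + single f σ b :=
  Finsupp.single_add σ a b

theorem single_mul_single (σ τ : Gal(K/E)) (a b : K) :
    single f σ a * single f τ b = single f (σ * τ) (a * σ b * f.val σ τ) := by
  simp only [mul_def]
  simp [single, -Finsupp.single_mul]

theorem induction_on {p : CrossedProduct f → Prop} (x : CrossedProduct f)
    (h0 : p 0) (hadd : ∀ x y, p x → p y → p (x + y)) (hs : ∀ σ a, p (single f σ a)) : p x :=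
  Finsupp.induction_linear (motive := p) x h0 hadd hs

theorem coeff_zero (σ : Gal(K/E)) : (0 : CrossedProduct f).coeff σ = 0 := rfl

theorem coeff_add (x y : CrossedProduct f) (σ : Gal(K/E)) :
    (x + y).coeff σ = x.coeff σ + y.coeff σ := rfl

theorem coeff_neg (x : CrossedProduct f) (σ : Gal(K/E)) : (-x).coeff σ = -x.coeff σ := rfl

theorem coeff_single [DecidableEq Gal(K/E)] (σ τ : Gal(K/E)) (a : K) :
    (single f σ a).coeff τ = if σ = τ then a else 0 := by
  simp [coeff, single, Finsupp.single_apply]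

theorem zero_mul' (x : CrossedProduct f) : 0 * x = 0 := by
  simp [mul_def]

theorem mul_zero' (x : CrossedProduct f) : x * 0 = 0 := by
  simp [mul_def]

theorem mul_add' (x y z : CrossedProduct f) : x * (y + z) = x * y + x * z := by
  simp only [mul_def, map_add]
  rw [← Finsupp.sum_add]
  refine Finsupp.sum_congr fun σ _ ↦ Finsupp.sum_add_index' ?_ ?_
  · intro τ; simp [single_zero]
  · intro τ b c; simp [mul_add, add_mul, single_add]

theorem add_mul' (x y z : CrossedProduct f) : (x + y) * z = x * z + y * z := by
  simp only [mul_def, map_add]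
  refine Finsupp.sum_add_index' ?_ ?_
  · intro σ; simp [single_zero]
  · intro σ a b; simp [add_mul, single_add]

instance : Ring (CrossedProduct f) where
  __ := (inferInstance : AddCommGroup (CrossedProduct f))
  __ := (inferInstance : Mul (CrossedProduct f))
  __ := (inferInstance : One (CrossedProduct f))
  left_distrib := mul_add'
  right_distrib := add_mul'
  zero_mul := zero_mul'
  mul_zero := mul_zero'
  one_mul x := by
    refine induction_on (p := fun x ↦ 1 * x = x) x (mul_zero' 1) ?_ ?_
    · intro x y hx hy; rw [mul_add', hx, hy]
    · intro σ a; rw [one_def, single_mul_single]; simp [f.val_one_left]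
  mul_one x := by
    refine induction_on (p := fun x ↦ x * 1 = x) x (zero_mul' 1) ?_ ?_
    · intro x y hx hy; rw [add_mul', hx, hy]
    · intro σ a; rw [one_def, single_mul_single]; simp [f.val_one_right]
  mul_assoc x y z := by
    refine induction_on (p := fun x ↦ x * y * z = x * (y * z)) x ?_ ?_ ?_
    · simp only [zero_mul']
    · intro x x' hx hx'; simp only [add_mul', hx, hx']
    intro σ a
    refine induction_on (p := fun y ↦ single f σ a * y * z = single f σ a * (y * z)) y ?_ ?_ ?_
    · simp only [zero_mul', mul_zero']
    · intro y y' hy hy'; simp only [add_mul', mul_add', hy, hy']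
    intro τ b
    refine induction_on
      (p := fun z ↦ single f σ a * single f τ b * z = single f σ a * (single f τ b * z)) z ?_ ?_ ?_
    · simp only [mul_zero']
    · intro z z' hz hz'; simp only [mul_add', hz, hz']
    intro ρ c
    simp only [single_mul_single, mul_assoc σ τ ρ]
    congr 1
    simp only [map_mul, AlgEquiv.mul_apply]
    linear_combination (a * σ b * σ (τ c)) * f.val_cocycle σ τ ρ

/-- The crossed product is an `E`-algebra through `e ↦ e x_1`. -/
instance : Algebra E (CrossedProduct f) :=
  RingHom.toAlgebra'
    { toFun := fun e ↦ single f 1 (algebraMap E K e)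
      map_one' := by rw [map_one]; rfl
      map_mul' := fun a b ↦ by rw [single_mul_single]; simp [f.val_one_left]
      map_zero' := by rw [map_zero]; exact single_zero 1
      map_add' := fun a b ↦ by rw [map_add]; exact single_add _ _ _ }
    (fun e x ↦ by
      refine induction_on (p := fun x ↦ single f 1 (algebraMap E K e) * x =
        x * single f 1 (algebraMap E K e)) x ?_ ?_ ?_
      · rw [zero_mul, mul_zero]
      · intro x y hx hy; rw [mul_add, add_mul, hx, hy]
      · intro σ a
        simp [single_mul_single, f.val_one_left, f.val_one_right, mul_comm])

theorem algebraMap_def (e : E) :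
    algebraMap E (CrossedProduct f) e = single f 1 (algebraMap E K e) := rfl

end

end CrossedProduct

theorem map_mem_integralClosure {E K : Type*} [Field E] [Field K] [Algebra E K]
    (V : ValuationSubring E) (σ : Gal(K/E)) {a : K} (ha : a ∈ integralClosure V K) :
    σ a ∈ integralClosure V K :=
  IsIntegral.map (σ.toAlgHom.restrictScalars V) ha

/-- The crossed-product order `A_f = ∑_{σ ∈ G} S x_σ` in `Σ_f`, where `S` is the integral closure
of `V` in `K`: the elements all of whose coordinates lie in `S`. It is a `V`-subalgebra of `Σ_f`
because `f` takes its values in `S`. -/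
noncomputable def crossedProductOrder {E K : Type*} [Field E] [Field K] [Algebra E K]
    (V : ValuationSubring E) (f : NormalizedTwoCocycle E K) (hf : f.IsIntegralOver V) :
    Subalgebra V (CrossedProduct f) where
  carrier := {x | ∀ σ : Gal(K/E), x.coeff σ ∈ integralClosure V K}
  zero_mem' σ := zero_mem (integralClosure V K)
  add_mem' hx hy σ := add_mem (hx σ) (hy σ)
  one_mem' σ := by
    classical
    rw [CrossedProduct.one_def, CrossedProduct.coeff_single]
    split_ifs
    exacts [one_mem _, zero_mem _]
  mul_mem' {x y} hx hy ρ := by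
    classical
    have key : (x * y).coeff ρ =
        ∑ σ ∈ (CrossedProduct.toFinsupp x).support, ∑ τ ∈ (CrossedProduct.toFinsupp y).support,
          (CrossedProduct.single f (σ * τ) (x.coeff σ * σ (y.coeff τ) * f.val σ τ)).coeff ρ := by
      rw [CrossedProduct.mul_def]
      simp only [CrossedProduct.coeff, Finsupp.sum, map_sum, Finsupp.finsetSum_apply]
    rw [key]
    refine sum_mem fun σ _ ↦ sum_mem fun τ _ ↦ ?_
    rw [CrossedProduct.coeff_single]
    split_ifs
    · exact mul_mem (mul_mem (hx σ) (map_mem_integralClosure V σ (hy τ))) (hf σ τ)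
    · exact zero_mem _
  algebraMap_mem' v σ := by
    classical
    have h : algebraMap V (CrossedProduct f) v =
        CrossedProduct.single f 1 (algebraMap E K (v : E)) := rfl
    rw [h, CrossedProduct.coeff_single]
    split_ifs
    · exact (integralClosure V K).algebraMap_mem v
    · exact zero_mem _

/-- If the valuation ring `U` of `L` lies over `V`, then the integral closure of `V` in `K` is
contained in that of `U`, so that the restriction of `f` to `G_L × G_L` takes its values in the
integral closure of `U`. -/
theorem NormalizedTwoCocycle.IsIntegralOver.restrict {E K : Type*} [Field E] [Field K]
    [Algebra E K] {f : NormalizedTwoCocycle E K} {V : ValuationSubring E}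
    (hf : f.IsIntegralOver V) {L : IntermediateField E K} {U : ValuationSubring L}
    (hU : U.comap (algebraMap E L) = V) : (f.restrict L).IsIntegralOver U := by
  intro σ τ
  obtain ⟨p, hp, h0⟩ := hf (σ.restrictScalars E) (τ.restrictScalars E)
  have hVU : ∀ v : V, algebraMap E L v ∈ U := fun v ↦
    (SetLike.ext_iff.mp hU (v : E)).mpr v.2
  let i : V →+* U := ((algebraMap E L).comp V.subtype).codRestrict U.toSubring hVU
  refine ⟨p.map i, hp.map i, ?_⟩
  rw [Polynomial.eval₂_map]
  exact h0

/-- A ring is hereditary if all its left ideals and all its right ideals are projective. -/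
def IsHereditaryRing (A : Type*) [Ring A] : Prop :=
  (∀ I : Submodule A A, Module.Projective A I) ∧
    ∀ I : Submodule Aᵐᵒᵖ A, Module.Projective Aᵐᵒᵖ I

/-- A `V`-order in an algebra over the quotient field `E` of `V`: a `V`-subalgebra (with the same
identity) which is finitely generated as a `V`-module and spans the algebra over `E`. -/
def IsOrderIn {E B : Type*} [Field E] [Ring B] [Algebra E B] (V : ValuationSubring E)
    (A : Subalgebra V B) : Prop :=
  (Subalgebra.toSubmodule A).IsLattice E

/-- A hereditary `V`-order: a `V`-order which is a hereditary ring. -/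
def IsHereditaryOrderIn {E B : Type*} [Field E] [Ring B] [Algebra E B] (V : ValuationSubring E)
    (A : Subalgebra V B) : Prop :=
  IsOrderIn V A ∧ IsHereditaryRing A

/-! ### Valuation rings of `K` over `V` and the integral closure. -/

section Places

variable {E K : Type*} [Field E] [Field K] [Algebra E K]

namespace ValuationSubring

/-! The theorem follows from a numerical criterion: `A_f` is hereditary exactly when no `f(σ, σ⁻¹)`
is divisible by the square of a maximal ideal of `S`, that is, `SquarefreeAt`. A uniformizer `π` of
`V` remains one at every place of `K`, and places over `U` are places over `V`, so the criterion for
`f` contains the criterion for its restriction (`SquarefreeAt.restrict`).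

Necessity (`lt_valuation_val_inv_of_projective`): if `π²` divides `f(τ⁻¹, τ)` at some place, the
left ideal generated by `π` and `x_τ` is not projective, since a dual basis would write `π` as a sum
of elements divisible by `π²` at that place.

Sufficiency (`SquarefreeAt.projective`): at a place `W`, "`f(σ, σ⁻¹τ)` is a unit" is a preorder `σ ≤
τ` on the group. It describes a two-sided ideal `J` with `A_f / J` semisimple and some power of `J`
inside `π A_f`. Under the criterion the preorder is total, and a greatest element among those not
below `1` yields a local inverse of `J`; gluing these makes `J` projective. A left ideal `I` is a
direct summand of some `I ⊕ I'` containing a power of `J`, and left ideals containing a power of `J`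
are projective by descent along `I + J^k`. Right ideals are handled through the opposite ring, again
a crossed-product order satisfying the criterion.

All that is needed about `V` and `S` is collected in `IsUnramifiedUniformizer`, which passes to `U`
directly, so that sufficiency can be applied over `U` without reproving discreteness or
unramifiedness there. -/

theorem valuation_lt_one_iff_inv {K : Type*} [Field K] (W : ValuationSubring K) (x : K) :
    W.valuation x < 1 ↔ x = 0 ∨ x⁻¹ ∉ W := by
  rcases eq_or_ne x 0 with rfl | hx
  · simp
  · rw [← W.valuation_le_one_iff, not_le, Valuation.one_lt_val_iff _ (inv_ne_zero hx), inv_inv]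
    simp [hx]

theorem valuation_le_iff_div_mem {K : Type*} [Field K] (W : ValuationSubring K) (x : K) {y : K}
    (hy : y ≠ 0) : W.valuation x ≤ W.valuation y ↔ x / y ∈ W := by
  rw [← W.valuation_le_one_iff, map_div₀, div_le_one₀]
  exact zero_lt_iff.mpr ((Valuation.ne_zero_iff _).mpr hy)

section comap

variable {K' : Type*} [Field K'] (W : ValuationSubring K') (φ : K →+* K') (x y : K)

theorem valuation_comap_le_one_iff : (W.comap φ).valuation x ≤ 1 ↔ W.valuation (φ x) ≤ 1 := by
  simp only [valuation_le_one_iff, mem_comap]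

theorem valuation_comap_lt_one_iff : (W.comap φ).valuation x < 1 ↔ W.valuation (φ x) < 1 := by
  simp only [valuation_lt_one_iff_inv, mem_comap, map_inv₀, map_eq_zero]

theorem valuation_comap_eq_one_iff : (W.comap φ).valuation x = 1 ↔ W.valuation (φ x) = 1 := by
  have h1 := W.valuation_comap_le_one_iff φ x
  have h2 := W.valuation_comap_lt_one_iff φ x
  rw [le_antisymm_iff, le_antisymm_iff, ← not_lt (b := 1), ← not_lt (b := 1), h1, h2]

theorem valuation_comap_le_iff :
    (W.comap φ).valuation x ≤ (W.comap φ).valuation y ↔ W.valuation (φ x) ≤ W.valuation (φ y) := by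
  rcases eq_or_ne y 0 with rfl | hy
  · simp
  · rw [valuation_le_iff_div_mem _ _ hy, valuation_le_iff_div_mem _ _ (by simpa using hy),
      mem_comap, map_div₀]

end comap

end ValuationSubring

/-- The valuation rings of `K` lying over the valuation ring `V` of `E`. -/
def placesOver (V : ValuationSubring E) (K : Type*) [Field K] [Algebra E K] :
    Set (ValuationSubring K) :=
  {W | W.comap (algebraMap E K) = V}

variable {V : ValuationSubring E} {W : ValuationSubring K}

theorem algebraMap_mem_iff_of_mem_placesOver (hW : W ∈ placesOver V K) {e : E} :
    algebraMap E K e ∈ W ↔ e ∈ V := by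
  rw [← ValuationSubring.mem_comap, show W.comap (algebraMap E K) = V from hW]

theorem valuation_algebraMap_lt_one_iff (hW : W ∈ placesOver V K) {e : E} :
    W.valuation (algebraMap E K e) < 1 ↔ V.valuation e < 1 := by
  rw [← ValuationSubring.valuation_comap_lt_one_iff, show W.comap (algebraMap E K) = V from hW]

theorem comap_mem_placesOver (hW : W ∈ placesOver V K) (σ : Gal(K/E)) :
    W.comap (σ : K →+* K) ∈ placesOver V K := by
  change (W.comap (σ : K →+* K)).comap (algebraMap E K) = V
  rw [ValuationSubring.comap_comap]
  have : (σ : K →+* K).comp (algebraMap E K) = algebraMap E K := by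
    ext; simp
  rw [this]; exact hW

theorem mem_of_mem_integralClosure (hW : W ∈ placesOver V K) {x : K}
    (hx : x ∈ integralClosure V K) : x ∈ W := by
  obtain ⟨p, hp, h0⟩ := hx
  let i : V →+* W := ((algebraMap E K).comp V.subtype).codRestrict W.toSubring
    fun v ↦ (algebraMap_mem_iff_of_mem_placesOver hW).mpr v.2
  have : IsIntegral W x := ⟨p.map i, hp.map i, by rw [Polynomial.eval₂_map]; exact h0⟩
  obtain ⟨y, rfl⟩ := IsIntegrallyClosed.isIntegral_iff.mp this
  exact y.2

theorem valuation_le_one_of_mem_integralClosure (hW : W ∈ placesOver V K) {x : K}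
    (hx : x ∈ integralClosure V K) : W.valuation x ≤ 1 :=
  (W.valuation_le_one_iff x).mpr (mem_of_mem_integralClosure hW hx)

/-- A valuation ring of `K` that dominates `V` lies over `V`. -/
theorem mem_placesOver_of_forall (h1 : ∀ e ∈ V, algebraMap E K e ∈ W)
    (h2 : ∀ e : E, V.valuation e < 1 → W.valuation (algebraMap E K e) < 1) :
    W ∈ placesOver V K := by
  refine SetLike.ext fun e ↦ ⟨fun he ↦ ?_, h1 e⟩
  by_contra hV
  have he0 : e ≠ 0 := by rintro rfl; exact hV (zero_mem _)
  have : V.valuation e⁻¹ < 1 := by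
    rw [V.valuation_lt_one_iff_inv, inv_inv]; exact .inr hV
  have := h2 _ this
  rw [W.valuation_lt_one_iff_inv, map_inv₀, inv_inv] at this
  rcases this with h | h
  · simp [he0] at h
  · exact h he

-- In `V[x⁻¹]` the ideal generated by the maximal ideal of `V` and `x⁻¹` is proper, since otherwise
-- `x` would be a root of a polynomial over `V` with unit leading coefficient. A valuation ring
-- dominating this ideal lies over `V` and has `x⁻¹` as a non-unit.
open Polynomial in
theorem exists_mem_placesOver_notMem {x : K} (hx : x ∉ integralClosure V K) :
    ∃ W ∈ placesOver V K, x ∉ W := by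
  obtain rfl | hx0 := eq_or_ne x 0
  · exact (hx (zero_mem _)).elim
  let := invertibleOfNonzero (inv_ne_zero hx0)
  have hne : (IsLocalRing.maximalIdeal V).map (algebraMap V (Algebra.adjoin V {x⁻¹})) ⊔
      .span {⟨x⁻¹, Algebra.subset_adjoin rfl⟩} ≠ ⊤ := fun eq ↦ by
    obtain ⟨p, hp, hpx⟩ := Algebra.exists_aeval_invOf_eq_zero_of_idealMap_adjoin_sup_span_eq_top x⁻¹
      (IsLocalRing.maximalIdeal V) (IsLocalRing.maximalIdeal.isMaximal V).ne_top eq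
    have H : IsUnit p.leadingCoeff := of_not_not fun h ↦ by simpa using sub_mem h hp
    refine hx ⟨.C H.unit⁻¹.1 * p, by simp [Polynomial.Monic], ?_⟩
    have : (⅟x⁻¹ : K) = x := by simp
    rw [this] at hpx
    have := hpx
    rw [Polynomial.aeval_def] at this
    rw [Polynomial.eval₂_mul, this, mul_zero]
  obtain ⟨W, hW1, hW2⟩ := Ideal.image_subset_nonunits_valuationSubring
    (A := (Algebra.adjoin V {x⁻¹}).toSubring) _ hne
  refine ⟨W, mem_placesOver_of_forall (fun e he ↦ ?_) (fun e he ↦ ?_), ?_⟩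
  · exact hW1 ((Algebra.adjoin V {x⁻¹}).algebraMap_mem ⟨e, he⟩)
  · have he' : e ∈ V := (V.valuation_le_one_iff e).mp he.le
    rw [← ValuationSubring.mem_nonunits_iff]
    refine hW2 ⟨_, le_sup_left (α := Ideal (Algebra.adjoin V {x⁻¹}))
      (Ideal.mem_map_of_mem _ ((V.valuation_lt_one_iff ⟨e, he'⟩).mpr he)), rfl⟩
  · have : W.valuation x⁻¹ < 1 := by
      rw [← ValuationSubring.mem_nonunits_iff]
      exact hW2 ⟨_, le_sup_right (α := Ideal (Algebra.adjoin V {x⁻¹}))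
        (Ideal.subset_span rfl), rfl⟩
    rw [W.valuation_lt_one_iff_inv, inv_inv] at this
    exact this.resolve_left (inv_ne_zero hx0)

theorem mem_integralClosure_iff_forall_mem {x : K} :
    x ∈ integralClosure V K ↔ ∀ W ∈ placesOver V K, x ∈ W :=
  ⟨fun hx _ hW ↦ mem_of_mem_integralClosure hW hx, fun h ↦ by
    by_contra hx
    obtain ⟨W, hW, hxW⟩ := exists_mem_placesOver_notMem hx
    exact hxW (h W hW)⟩

theorem mem_integralClosure_iff_forall_valuation_le_one {x : K} :
    x ∈ integralClosure V K ↔ ∀ W ∈ placesOver V K, W.valuation x ≤ 1 := by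
  simp only [mem_integralClosure_iff_forall_mem, ValuationSubring.valuation_le_one_iff]

theorem algebraMap_mem_integralClosure_iff {e : E} :
    algebraMap E K e ∈ integralClosure V K ↔ e ∈ V := by
  refine ⟨fun h ↦ ?_, fun h ↦ (integralClosure V K).algebraMap_mem ⟨e, h⟩⟩
  have : IsIntegral V e := (isIntegral_algHom_iff (IsScalarTower.toAlgHom V E K)
    (algebraMap E K).injective).mp h
  obtain ⟨y, rfl⟩ := IsIntegrallyClosed.isIntegral_iff.mp this
  exact y.2

theorem exists_mem_placesOver {e : E} (he : e ∉ V) : ∃ W, W ∈ placesOver V K := by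
  obtain ⟨W, hW, -⟩ := exists_mem_placesOver_notMem (V := V) (K := K)
    (mt algebraMap_mem_integralClosure_iff.mp he)
  exact ⟨W, hW⟩

/-- `π` is a uniformizer of the valuation ring `V` of `E`, and of all the valuation rings of
`K` over `V`; these are finite in number and independent, and the integral closure `S` of `V` in
`K` is a Galois extension of `V` with group `Gal(K/E)`: there are dual families `a`, `b` in `S`. -/
structure IsUnramifiedUniformizer (V : ValuationSubring E) (K : Type*) [Field K] [Algebra E K]
    (π : E) : Prop where
  ne_zero : π ≠ 0
  valuation_lt_one : V.valuation π < 1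
  exists_pow_mul_mem : ∀ x : K, ∃ k : ℕ, algebraMap E K π ^ k * x ∈ integralClosure V K
  valuation_le : ∀ W ∈ placesOver V K, ∀ x : K,
    W.valuation x < 1 → W.valuation x ≤ W.valuation (algebraMap E K π)
  finite : (placesOver V K).Finite
  separated : ∀ W ∈ placesOver V K, ∃ c ∈ integralClosure V K, W.valuation c = 1 ∧
    ∀ W' ∈ placesOver V K, W' ≠ W → W'.valuation c < 1
  dual : ∃ (n : ℕ) (a b : Fin n → K), (∀ i, a i ∈ integralClosure V K) ∧
    (∀ i, b i ∈ integralClosure V K) ∧ ∑ i, a i * b i = 1 ∧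
    ∀ σ : Gal(K/E), σ ≠ 1 → ∑ i, a i * σ (b i) = 0

end Places

open scoped TensorProduct

/-! ### Consequences of unramifiedness over a discrete valuation ring. -/

section Galois

variable {F K : Type*} [Field F] [Field K] [Algebra F K] {V : ValuationSubring F}

/-- The centre on the integral closure of `V` of a valuation ring lying over `V`. -/
noncomputable def placeIdeal {W : ValuationSubring K} (hW : W ∈ placesOver V K) :
    Ideal (integralClosure V K) :=
  (IsLocalRing.maximalIdeal W).comap
    ((integralClosure V K).val.toRingHom.codRestrict W.toSubring
      fun s ↦ mem_of_mem_integralClosure hW s.2)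

theorem mem_placeIdeal {W : ValuationSubring K} (hW : W ∈ placesOver V K)
    (s : integralClosure V K) : s ∈ placeIdeal hW ↔ W.valuation (s : K) < 1 :=
  W.valuation_lt_one_iff ⟨s, mem_of_mem_integralClosure hW s.2⟩

theorem valuation_eq_one_of_notMem_placeIdeal {W : ValuationSubring K} (hW : W ∈ placesOver V K)
    {s : integralClosure V K} (hs : s ∉ placeIdeal hW) : W.valuation (s : K) = 1 :=
  le_antisymm (valuation_le_one_of_mem_integralClosure hW s.2)
    (not_lt.mp (mt (mem_placeIdeal hW s).mpr hs))

theorem placeIdeal_mem_primesOver {W : ValuationSubring K} (hW : W ∈ placesOver V K) :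
    placeIdeal hW ∈ (IsLocalRing.maximalIdeal V).primesOver (integralClosure V K) := by
  refine ⟨Ideal.comap_isPrime _ _, ⟨?_⟩⟩
  ext v
  rw [Ideal.under, Ideal.mem_comap, mem_placeIdeal, V.valuation_lt_one_iff]
  exact (valuation_algebraMap_lt_one_iff hW).symm

theorem exists_mem_notMem_of_isMaximal {R : Type*} [CommRing R] {s : Set (Ideal R)}
    (hs : s.Finite) (hmax : ∀ I ∈ s, I.IsMaximal) {M : Ideal R} (hM : M ∈ s) :
    ∃ c ∉ M, ∀ I ∈ s, I ≠ M → c ∈ I := by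
  classical
  have := hmax M hM
  have hnot : ¬ (hs.toFinset.erase M).inf id ≤ M := fun h ↦ by
    obtain ⟨I, hI, hIM⟩ := (Ideal.IsPrime.inf_le' (hmax M hM).isPrime).mp h
    rw [Finset.mem_erase, Set.Finite.mem_toFinset] at hI
    exact hI.1 ((hmax I hI.2).eq_of_le (hmax M hM).ne_top hIM)
  obtain ⟨c, hc, hcM⟩ := SetLike.not_le_iff_exists.mp hnot
  refine ⟨c, hcM, fun I hI hIM ↦ ?_⟩
  exact (Finset.inf_le (f := id) (Finset.mem_erase.mpr ⟨hIM, hs.mem_toFinset.mpr hI⟩)) hc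

theorem valuation_irreducible_lt_one {π : V} (hπ : Irreducible π) : V.valuation (π : F) < 1 :=
  (V.valuation_lt_one_iff π).mp ((IsLocalRing.mem_maximalIdeal π).mpr hπ.not_isUnit)

variable [IsGalois F K] [IsDiscreteValuationRing V]

theorem exists_pow_mul_mem_integralClosure {π : V} (hπ : Irreducible π) (x : K) :
    ∃ k : ℕ, algebraMap F K π ^ k * x ∈ integralClosure V K := by
  have : Algebra.IsAlgebraic V K :=
    (IsFractionRing.comap_isAlgebraic_iff (A := V) (K := F) (C := K)).mpr inferInstance
  obtain ⟨y, hy, hyx⟩ := (Algebra.IsAlgebraic.isAlgebraic (R := V) x).exists_integral_multiple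
  obtain ⟨k, u, rfl⟩ := IsDiscreteValuationRing.eq_unit_mul_pow_irreducible hy hπ
  refine ⟨k, ?_⟩
  have h := (integralClosure V K).smul_mem (x := ((u : V) * π ^ k) • x) hyx (↑u⁻¹ : V)
  rw [smul_smul, ← mul_assoc, Units.inv_mul, one_mul, Algebra.smul_def, map_pow] at h
  exact h

theorem exists_mem_integralClosure_ne {π : V} (hπ : Irreducible π) {σ : Gal(K/F)} (hσ : σ ≠ 1) :
    ∃ s ∈ integralClosure V K, σ s ≠ s := by
  by_contra! h
  refine hσ (AlgEquiv.ext fun x ↦ ?_)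
  obtain ⟨k, hk⟩ := exists_pow_mul_mem_integralClosure (K := K) hπ x
  have := h _ hk
  rw [map_mul, map_pow, AlgEquiv.commutes] at this
  refine mul_left_cancel₀ (pow_ne_zero k ?_) this
  rw [Ne, map_eq_zero]
  exact fun h ↦ hπ.ne_zero (Subtype.ext h)

variable [FiniteDimensional F K]

-- The families come from the element `t` of `S ⊗ S` attached to an unramified algebra. Its product
-- is `1`, and `(1 ⊗ s - s ⊗ 1) t = 0`. Applying `a ⊗ b ↦ a σ(b)` gives `(σ s - s) ∑ a_i σ(b_i) =
-- 0`, where `s` may be chosen with `σ s ≠ s`.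
variable (K V) in
theorem exists_dual_families [Algebra.FormallyUnramified V (integralClosure V K)] :
    ∃ (n : ℕ) (a b : Fin n → K), (∀ i, a i ∈ integralClosure V K) ∧
      (∀ i, b i ∈ integralClosure V K) ∧ ∑ i, a i * b i = 1 ∧
      ∀ σ : Gal(K/F), σ ≠ 1 → ∑ i, a i * σ (b i) = 0 := by
  have : Module.Finite V (integralClosure V K) := IsIntegralClosure.finite V F K _
  obtain ⟨π, hπ⟩ := IsDiscreteValuationRing.exists_irreducible V
  let t := Algebra.FormallyUnramified.elem V (integralClosure V K)
  obtain ⟨s, hs⟩ := TensorProduct.exists_multiset t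
  let φ (σ : Gal(K/F)) : integralClosure V K ⊗[V] integralClosure V K →ₐ[V] K :=
    Algebra.TensorProduct.lift (integralClosure V K).val
      (((σ : K →ₐ[F] K).restrictScalars V).comp (integralClosure V K).val) fun _ _ ↦ .all _ _
  let l := s.toList
  have hφ (σ : Gal(K/F)) : φ σ t = ∑ i : Fin l.length, ((l.get i).1 : K) * σ ((l.get i).2 : K) := by
    rw [hs, ← Multiset.coe_toList s, Multiset.map_coe, Multiset.sum_coe, map_list_sum,
      List.map_map, ← List.sum_ofFn]
    congr 1
    apply List.ext_get <;> simp [φ, l]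
  refine ⟨l.length, fun i ↦ (l.get i).1, fun i ↦ (l.get i).2, fun i ↦ (l.get i).1.2,
    fun i ↦ (l.get i).2.2, ?_, fun σ hσ ↦ ?_⟩
  · have h1 : φ 1 = (integralClosure V K).val.comp (Algebra.TensorProduct.lmul' V) := by
      ext <;> simp [φ]
    have h2 := hφ 1
    rw [h1, AlgHom.comp_apply, Algebra.FormallyUnramified.lmul_elem, map_one] at h2
    exact h2.symm
  · rw [← hφ]
    obtain ⟨s, hs, hne⟩ := exists_mem_integralClosure_ne hπ hσ
    have := congrArg (φ σ)
      (Algebra.FormallyUnramified.one_tmul_sub_tmul_one_mul_elem (R := V)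
        (⟨s, hs⟩ : integralClosure V K))
    rw [map_mul, map_zero, mul_eq_zero] at this
    refine this.resolve_left ?_
    simpa [φ, sub_eq_zero] using hne

-- Every `x` is a combination of the `a_i` whose coefficients are the traces of the `b_i x`.
omit [IsGalois F K] in
theorem sum_mul_sum_dual {n : ℕ} {a b : Fin n → K} (h1 : ∑ i, a i * b i = 1)
    (h0 : ∀ σ : Gal(K/F), σ ≠ 1 → ∑ i, a i * σ (b i) = 0) (x : K) :
    ∑ i, a i * ∑ σ : Gal(K/F), σ (b i * x) = x := by
  calc _ = ∑ σ : Gal(K/F), (∑ i, a i * σ (b i)) * σ x := by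
        simp only [Finset.sum_mul, Finset.mul_sum]
        rw [Finset.sum_comm]
        simp only [map_mul, mul_assoc]
    _ = x := by
        rw [Finset.sum_eq_single (1 : Gal(K/F))]
        · simp [h1]
        · intro σ _ hσ; rw [h0 σ hσ, zero_mul]
        · simp

/-- This is where ramification index `1` enters: the intersection of the maximal ideals of `S` is
`πS`. All conjugates of `b_i x` are non-units at one fixed place, hence so is its trace, which lies
in `F` and is therefore a multiple of `π` in `V`. The expansion of `x` in the `a_i` does the rest.
-/
theorem exists_eq_mul_of_forall_valuation_lt_one
    [Algebra.FormallyUnramified V (integralClosure V K)] {π : V} (hπ : Irreducible π) {x : K}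
    (hx : ∀ W ∈ placesOver V K, W.valuation x < 1) :
    ∃ y ∈ integralClosure V K, x = algebraMap F K π * y := by
  obtain ⟨n, a, b, ha, hb, h1, h0⟩ := exists_dual_families K V
  have hπ0 : (π : F) ≠ 0 := fun h ↦ hπ.ne_zero (Subtype.ext h)
  have hnV : ((π : F)⁻¹) ∉ V := fun h ↦ hπ.not_isUnit
    (IsUnit.of_mul_eq_one ⟨_, h⟩ (Subtype.ext (mul_inv_cancel₀ hπ0)))
  obtain ⟨W₀, hW₀⟩ := exists_mem_placesOver (K := K) hnV
  have key (i : Fin n) : ∃ v : V, ∑ σ : Gal(K/F), σ (b i * x) = algebraMap F K (π * v : V) := by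
    have hlt : ∀ σ : Gal(K/F), W₀.valuation (σ (b i * x)) < 1 := fun σ ↦ by
      have hW := comap_mem_placesOver hW₀ σ
      refine (W₀.valuation_comap_lt_one_iff (σ : K →+* K) _).mp ?_
      rw [map_mul]
      exact mul_lt_one_of_nonneg_of_lt_one_right
        (valuation_le_one_of_mem_integralClosure hW (hb i)) zero_le (hx _ hW)
    obtain ⟨e, he⟩ := (IsGalois.mem_range_algebraMap_iff_fixed
      (∑ σ : Gal(K/F), σ (b i * x))).mpr fun τ ↦ by
        rw [map_sum]
        exact Fintype.sum_equiv (Equiv.mulLeft τ) _ _ fun σ ↦ rfl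
    have hev : V.valuation e < 1 := by
      rw [← valuation_algebraMap_lt_one_iff hW₀, he]
      exact Valuation.map_sum_lt _ one_ne_zero fun σ _ ↦ hlt σ
    have heV : e ∈ V := (V.valuation_le_one_iff e).mp hev.le
    have hem : (⟨e, heV⟩ : V) ∈ IsLocalRing.maximalIdeal V := (V.valuation_lt_one_iff _).mpr hev
    rw [hπ.maximalIdeal_eq, Ideal.mem_span_singleton] at hem
    obtain ⟨v, hv⟩ := hem
    exact ⟨v, by rw [← he, ← hv]⟩
  choose v hv using key
  refine ⟨∑ i, a i * algebraMap F K (v i), sum_mem fun i _ ↦ mul_mem (ha i)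
    ((integralClosure V K).algebraMap_mem (v i)), ?_⟩
  rw [← sum_mul_sum_dual h1 h0 x, Finset.mul_sum]
  refine Finset.sum_congr rfl fun i _ ↦ ?_
  rw [hv]
  simp only [MulMemClass.coe_mul, map_mul]
  ring

variable [Algebra.FormallyUnramified V (integralClosure V K)]

theorem exists_separating_placeIdeal {W : ValuationSubring K} (hW : W ∈ placesOver V K) :
    ∃ c ∈ integralClosure V K, W.valuation c = 1 ∧ ∀ W', ∀ hW' : W' ∈ placesOver V K,
      placeIdeal hW' ≠ placeIdeal hW → W'.valuation c < 1 := by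
  have : Module.Finite V (integralClosure V K) := IsIntegralClosure.finite V F K _
  obtain ⟨c, hc, h⟩ := exists_mem_notMem_of_isMaximal
    (Algebra.QuasiFinite.finite_primesOver (S := integralClosure V K) (IsLocalRing.maximalIdeal V))
    (fun I hI ↦ by
      have := hI.1
      refine Ideal.isMaximal_of_isIntegral_of_isMaximal_comap (R := V) I ?_
      rw [← show _ = I.comap _ from hI.2.over]
      infer_instance) (placeIdeal_mem_primesOver hW)
  exact ⟨c, c.2, valuation_eq_one_of_notMem_placeIdeal hW hc, fun W' hW' hne ↦
    (mem_placeIdeal hW' c).mp (h _ (placeIdeal_mem_primesOver hW') hne)⟩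

/-- A local factorization of `s` as a power of `π` times a unit, obtained by induction on a bound
`m` for the order of `s`. If `s` is a non-unit at `W`, multiplying by a `c` that lies in all other
centres but not in that of `W` makes it divisible by `π`, and the quotient has a smaller bound. -/
theorem exists_mul_eq_pow_mul {π : V} (hπ : Irreducible π) {W : ValuationSubring K}
    (hW : W ∈ placesOver V K) {s : K} (hs : s ∈ integralClosure V K) (hs0 : s ≠ 0) :
    ∃ (k : ℕ) (u w : K) (hu : u ∈ integralClosure V K) (hw : w ∈ integralClosure V K),
      ⟨u, hu⟩ ∉ placeIdeal hW ∧ ⟨w, hw⟩ ∉ placeIdeal hW ∧ w * s = algebraMap F K π ^ k * u := by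
  have hπK : algebraMap F K (π : F) ≠ 0 := by
    rw [Ne, map_eq_zero]; exact fun h ↦ hπ.ne_zero (Subtype.ext h)
  have hv0 : W.valuation (algebraMap F K (π : F)) ≠ 0 := (Valuation.ne_zero_iff _).mpr hπK
  obtain ⟨m, hm⟩ : ∃ m : ℕ, W.valuation (algebraMap F K (π : F)) ^ m ≤ W.valuation s := by
    obtain ⟨m, hm⟩ := exists_pow_mul_mem_integralClosure hπ s⁻¹
    refine ⟨m, ?_⟩
    have := valuation_le_one_of_mem_integralClosure hW hm
    rwa [map_mul, map_inv₀, map_pow, ← div_eq_mul_inv, div_le_one₀] at this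
    exact zero_lt_iff.mpr ((Valuation.ne_zero_iff _).mpr hs0)
  induction m generalizing s with
  | zero =>
    refine ⟨0, s, 1, hs, one_mem _, ?_, ?_, by simp⟩
    · rw [mem_placeIdeal, not_lt]
      simpa using hm
    · rw [mem_placeIdeal, map_one]; exact lt_irrefl _
  | succ m ih =>
    by_cases h : (⟨s, hs⟩ : integralClosure V K) ∈ placeIdeal hW
    · obtain ⟨c, hc, hc1, hlt⟩ := exists_separating_placeIdeal hW
      obtain ⟨y, hy, hcy⟩ := exists_eq_mul_of_forall_valuation_lt_one hπ (x := c * s) fun W' hW' ↦ by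
        rw [map_mul]
        by_cases hne : placeIdeal hW' = placeIdeal hW
        · rw [← hne, mem_placeIdeal] at h
          exact mul_lt_one_of_nonneg_of_lt_one_right
            (valuation_le_one_of_mem_integralClosure hW' hc) zero_le h
        · exact mul_lt_one_of_nonneg_of_lt_one_left zero_le (hlt _ hW' hne)
            (valuation_le_one_of_mem_integralClosure hW' hs)
      have hc0 : c ≠ 0 := by rintro rfl; simp at hc1
      have hy0 : y ≠ 0 := by
        rintro rfl
        rw [mul_zero] at hcy
        exact mul_ne_zero hc0 hs0 hcy
      have hvy : W.valuation s = W.valuation (algebraMap F K (π : F)) * W.valuation y := by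
        rw [← map_mul, ← hcy, map_mul, hc1, one_mul]
      rw [hvy, pow_succ'] at hm
      obtain ⟨k, u, w, hu, hw, hu1, hw1, e⟩ := ih hy hy0
        ((mul_le_mul_iff_right₀ (zero_lt_iff.mpr hv0)).mp hm)
      refine ⟨k + 1, u, w * c, hu, mul_mem hw hc, hu1, ?_, ?_⟩
      · rw [mem_placeIdeal, map_mul, hc1, mul_one]
        rwa [mem_placeIdeal] at hw1
      · rw [mul_assoc, hcy, pow_succ']
        linear_combination algebraMap F K (π : F) * e
    · refine ⟨0, s, 1, hs, one_mem _, h, ?_, by simp⟩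
      rw [mem_placeIdeal, map_one]; exact lt_irrefl _

theorem exists_pow_mul_eq_pow_mul {π : V} (hπ : Irreducible π) {W : ValuationSubring K}
    (hW : W ∈ placesOver V K) {x : K} (hx0 : x ≠ 0) :
    ∃ (k l : ℕ) (u w : K) (hu : u ∈ integralClosure V K) (hw : w ∈ integralClosure V K),
      ⟨u, hu⟩ ∉ placeIdeal hW ∧ ⟨w, hw⟩ ∉ placeIdeal hW ∧
      w * algebraMap F K π ^ l * x = algebraMap F K π ^ k * u := by
  have hπK : algebraMap F K (π : F) ≠ 0 := by
    rw [Ne, map_eq_zero]; exact fun h ↦ hπ.ne_zero (Subtype.ext h)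
  obtain ⟨l, hl⟩ := exists_pow_mul_mem_integralClosure hπ x
  obtain ⟨k, u, w, hu, hw, hu1, hw1, e⟩ :=
    exists_mul_eq_pow_mul hπ hW hl (mul_ne_zero (pow_ne_zero _ hπK) hx0)
  exact ⟨k, l, u, w, hu, hw, hu1, hw1, by rw [mul_assoc, e]⟩

theorem exists_valuation_mul_pow_eq {π : V} (hπ : Irreducible π) {W : ValuationSubring K}
    (hW : W ∈ placesOver V K) {x : K} (hx0 : x ≠ 0) :
    ∃ k l : ℕ, ∀ W', ∀ hW' : W' ∈ placesOver V K, placeIdeal hW' = placeIdeal hW →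
      W'.valuation (algebraMap F K π) ^ l * W'.valuation x =
        W'.valuation (algebraMap F K π) ^ k := by
  obtain ⟨k, l, u, w, hu, hw, hu1, hw1, e⟩ := exists_pow_mul_eq_pow_mul hπ hW hx0
  refine ⟨k, l, fun W' hW' h ↦ ?_⟩
  rw [← h] at hu1 hw1
  have := congrArg W'.valuation e
  simp only [map_mul, map_pow] at this
  rwa [valuation_eq_one_of_notMem_placeIdeal hW' hu1,
    valuation_eq_one_of_notMem_placeIdeal hW' hw1, one_mul, mul_one] at this

/-- The exponents `k` and `l` attached to `x` depend only on the centre, and `x ∈ W` means `l ≤ k`.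
Hence places embed into the primes of `S` over the maximal ideal of `V`, which gives finiteness. -/
theorem eq_of_placeIdeal_eq {W W' : ValuationSubring K}
    (hW : W ∈ placesOver V K) (hW' : W' ∈ placesOver V K) (h : placeIdeal hW' = placeIdeal hW) :
    W = W' := by
  obtain ⟨π, hπ⟩ := IsDiscreteValuationRing.exists_irreducible V
  have hπK : algebraMap F K (π : F) ≠ 0 := by
    rw [Ne, map_eq_zero]; exact fun h ↦ hπ.ne_zero (Subtype.ext h)
  have hlt {W : ValuationSubring K} (hW : W ∈ placesOver V K) :=
    (valuation_algebraMap_lt_one_iff hW).mpr (valuation_irreducible_lt_one hπ)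
  have hpos {W : ValuationSubring K} : 0 < W.valuation (algebraMap F K (π : F)) :=
    zero_lt_iff.mpr ((Valuation.ne_zero_iff _).mpr hπK)
  have key {W : ValuationSubring K} (hW : W ∈ placesOver V K) {x : K} {k l : ℕ}
      (e : W.valuation (algebraMap F K (π : F)) ^ l * W.valuation x =
        W.valuation (algebraMap F K (π : F)) ^ k) : x ∈ W ↔ l ≤ k := by
    rw [← pow_le_pow_iff_right_of_lt_one₀ hpos (hlt hW), ← e, ← W.valuation_le_one_iff,
      mul_le_iff_le_one_right (pow_pos hpos _)]
  ext x
  rcases eq_or_ne x 0 with rfl | hx0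
  · simp only [zero_mem]
  obtain ⟨k, l, hkl⟩ := exists_valuation_mul_pow_eq hπ hW hx0
  rw [key hW (hkl W hW rfl), key hW' (hkl W' hW' h)]

theorem isUnramifiedUniformizer {π : V} (hπ : Irreducible π) :
    IsUnramifiedUniformizer V K (π : F) where
  ne_zero h := hπ.ne_zero (Subtype.ext h)
  valuation_lt_one := valuation_irreducible_lt_one hπ
  exists_pow_mul_mem := exists_pow_mul_mem_integralClosure hπ
  valuation_le W hW x hx := by
    rcases eq_or_ne x 0 with rfl | hx0
    · simp
    have hπK : algebraMap F K (π : F) ≠ 0 := by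
      rw [Ne, map_eq_zero]; exact fun h ↦ hπ.ne_zero (Subtype.ext h)
    have hlt := (valuation_algebraMap_lt_one_iff hW).mpr (valuation_irreducible_lt_one hπ)
    have hpos : 0 < W.valuation (algebraMap F K (π : F)) :=
      zero_lt_iff.mpr ((Valuation.ne_zero_iff _).mpr hπK)
    obtain ⟨k, l, hkl⟩ := exists_valuation_mul_pow_eq hπ hW hx0
    have e := hkl W hW rfl
    have hlk : l < k := by
      rw [← pow_lt_pow_iff_right_of_lt_one₀ hpos hlt, ← e]
      exact mul_lt_of_lt_one_right (pow_pos hpos _) hx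
    rw [← mul_le_mul_iff_right₀ (pow_pos hpos l), e, ← pow_succ]
    exact pow_le_pow_of_le_one zero_le hlt.le hlk
  finite := by
    have : Module.Finite V (integralClosure V K) := IsIntegralClosure.finite V F K _
    have := (Algebra.QuasiFinite.finite_primesOver (S := integralClosure V K)
      (IsLocalRing.maximalIdeal V)).to_subtype
    have hinj : Function.Injective fun W : placesOver V K ↦
        (⟨placeIdeal W.2, placeIdeal_mem_primesOver W.2⟩ :
          (IsLocalRing.maximalIdeal V).primesOver (integralClosure V K)) := fun W W' h ↦
      Subtype.ext (eq_of_placeIdeal_eq W.2 W'.2 (congrArg Subtype.val h).symm)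
    have := Finite.of_injective _ hinj
    exact Set.toFinite _
  separated W hW := by
    obtain ⟨c, hc, hc1, h⟩ := exists_separating_placeIdeal hW
    exact ⟨c, hc, hc1, fun W' hW' hne ↦ h W' hW' fun he ↦ hne (eq_of_placeIdeal_eq hW hW' he).symm⟩
  dual := exists_dual_families K V

end Galois

/-! ### Passage from `V` to a valuation ring `U` of an intermediate field. -/

section Tower

variable {F L K : Type*} [Field F] [Field L] [Field K] [Algebra F L] [Algebra F K] [Algebra L K]
  [IsScalarTower F L K] {V : ValuationSubring F} {U : ValuationSubring L}

theorem mem_placesOver_of_tower (hU : U ∈ placesOver V L) {W : ValuationSubring K}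
    (hW : W ∈ placesOver U K) : W ∈ placesOver V K := by
  change W.comap (algebraMap F K) = V
  rw [IsScalarTower.algebraMap_eq F L K, ← ValuationSubring.comap_comap,
    show W.comap (algebraMap L K) = U from hW, show U.comap (algebraMap F L) = V from hU]

theorem mem_integralClosure_of_tower (hU : U ∈ placesOver V L) {x : K}
    (hx : x ∈ integralClosure V K) : x ∈ integralClosure U K :=
  mem_integralClosure_iff_forall_mem.mpr fun _ hW ↦
    mem_of_mem_integralClosure (mem_placesOver_of_tower hU hW) hx

/-- Every condition survives because places over `U` are places over `V`, `S ⊆ T`, and a nontrivial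
automorphism over `L` is nontrivial over `F`. -/
theorem IsUnramifiedUniformizer.tower {π : F} (h : IsUnramifiedUniformizer V K π)
    (hU : U ∈ placesOver V L) : IsUnramifiedUniformizer U K (algebraMap F L π) where
  ne_zero := by rw [Ne, map_eq_zero]; exact h.ne_zero
  valuation_lt_one := (valuation_algebraMap_lt_one_iff hU).mpr h.valuation_lt_one
  exists_pow_mul_mem x := by
    obtain ⟨k, hk⟩ := h.exists_pow_mul_mem x
    rw [← IsScalarTower.algebraMap_apply]
    exact ⟨k, mem_integralClosure_of_tower hU hk⟩
  valuation_le W hW x hx := by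
    rw [← IsScalarTower.algebraMap_apply]
    exact h.valuation_le W (mem_placesOver_of_tower hU hW) x hx
  finite := h.finite.subset fun _ ↦ mem_placesOver_of_tower hU
  separated W hW := by
    obtain ⟨c, hc, hc1, hlt⟩ := h.separated W (mem_placesOver_of_tower hU hW)
    exact ⟨c, mem_integralClosure_of_tower hU hc, hc1,
      fun W' hW' ↦ hlt W' (mem_placesOver_of_tower hU hW')⟩
  dual := by
    obtain ⟨n, a, b, ha, hb, h1, h0⟩ := h.dual
    refine ⟨n, a, b, fun i ↦ mem_integralClosure_of_tower hU (ha i),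
      fun i ↦ mem_integralClosure_of_tower hU (hb i), h1, fun σ hσ ↦ ?_⟩
    refine h0 (σ.restrictScalars F) fun e ↦ hσ (AlgEquiv.ext fun x ↦ ?_)
    exact DFunLike.congr_fun e x

end Tower

/-! ### Projectivity of left ideals in a noncommutative ring. -/

section RingTheory

variable {R : Type*} [Ring R]

/-- If `J` is a two-sided ideal which is projective as a left module and `R ⧸ J` is semisimple,
then a submodule of a projective module that contains `J` times the module is projective. -/
theorem Submodule.projective_of_smul_mem (J : Ideal R) [J.IsTwoSided] [IsSemisimpleRing (R ⧸ J)]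
    [Module.Projective R J] {M : Type*} [AddCommGroup M] [Module R M] [Module.Projective R M]
    (N : Submodule R M) (h : ∀ j ∈ J, ∀ m : M, j • m ∈ N) : Module.Projective R N := by
  have htor : Module.IsTorsionBySet R (M ⧸ N) J := by
    intro x j
    obtain ⟨m, rfl⟩ := N.mkQ_surjective x
    exact (Submodule.Quotient.mk_eq_zero N).mpr (h j j.2 m)
  let := htor.module
  -- Schanuel-type argument. As `M ⧸ N` is projective over `R ⧸ J`, its section `s` lifts to a map
  -- `g` from `M` to a free `R`-module. With `r` lifting the evaluation map, `(m, j) ↦ m - r (g m) +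
  -- r j` lands in `N` and is a retraction of `n ↦ (n, g n)`. Thus `N` is a direct summand of `M`
  -- plus copies of `J`.
  have hproj : Module.Projective (R ⧸ J) (M ⧸ N) :=
    Module.projective_of_isSemisimpleRing _ _
  have hfin : Module.Projective R ((M ⧸ N) →₀ J) := by
    classical
    exact Module.Projective.of_equiv' (finsuppLequivDFinsupp R).symm
  obtain ⟨s, hs⟩ := Module.projective_def'.mp hproj
  let q := N.mkQ
  let p : ((M ⧸ N) →₀ R) →ₗ[R] ((M ⧸ N) →₀ R ⧸ J) :=
    Finsupp.mapRange.linearMap J.mkQ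
  have hp : Function.Surjective p := Finsupp.mapRange_surjective _ (map_zero _) J.mkQ_surjective
  obtain ⟨g, hg⟩ := Module.projective_lifting_property p ((s.restrictScalars R).comp q) hp
  let r : ((M ⧸ N) →₀ R) →ₗ[R] M := Finsupp.linearCombination R fun x ↦ (N.mkQ_surjective x).choose
  have hr (x : (M ⧸ N) →₀ R) : q (r x) = Finsupp.linearCombination (R ⧸ J) id (p x) := by
    induction x using Finsupp.induction_linear with
    | zero => simp
    | add x y hx hy => simp only [map_add, hx, hy]
    | single a b =>
      simp only [r, p, Finsupp.linearCombination_single, Finsupp.mapRange.linearMap_apply,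
        Finsupp.mapRange_single, map_smul, id]
      rw [(N.mkQ_surjective a).choose_spec]
      rfl
  let ι : ((M ⧸ N) →₀ J) →ₗ[R] ((M ⧸ N) →₀ R) := Finsupp.mapRange.linearMap J.subtype
  have hι : Function.Injective ι :=
    Finsupp.mapRange_injective _ (map_zero _) J.injective_subtype
  have hrange {x : (M ⧸ N) →₀ R} (hx : p x = 0) : x ∈ LinearMap.range ι := by
    have hx' (a) : x a ∈ J := by
      have := DFunLike.congr_fun hx a
      exact (Submodule.Quotient.mk_eq_zero J).mp this
    refine ⟨x.support.sum fun a ↦ Finsupp.single a ⟨x a, hx' a⟩, ?_⟩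
    rw [map_sum]
    simp only [ι, Finsupp.mapRange.linearMap_apply, Finsupp.mapRange_single]
    exact Finsupp.sum_single x
  have hgm (m : M) : p (g m) = s (q m) := LinearMap.congr_fun hg m
  have hgn (n : N) : g n ∈ LinearMap.range ι := hrange (by
    rw [hgm, show q n = 0 from (Submodule.Quotient.mk_eq_zero N).mpr n.2, map_zero])
  let i : N →ₗ[R] M × ((M ⧸ N) →₀ J) :=
    N.subtype.prod ((LinearEquiv.ofInjective ι hι).symm.toLinearMap.comp
      ((g.comp N.subtype).codRestrict _ hgn))
  have hιi (n : N) : ι (i n).2 = g n := by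
    have := (LinearEquiv.ofInjective ι hι).apply_symm_apply
      ((g.comp N.subtype).codRestrict _ hgn n)
    exact congrArg Subtype.val this
  let φ : M × ((M ⧸ N) →₀ J) →ₗ[R] M :=
    LinearMap.coprod (LinearMap.id - r.comp g) (r.comp ι)
  have hφ (x) : φ x ∈ N := by
    rw [← Submodule.Quotient.mk_eq_zero]
    change q (φ x) = 0
    have h1 : p (ι x.2) = 0 := by
      ext a
      exact (Submodule.Quotient.mk_eq_zero J).mpr (x.2 a).2
    simp only [φ, LinearMap.coprod_apply, LinearMap.sub_apply, LinearMap.comp_apply, map_add,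
      map_sub, hr, hgm, h1, map_zero, add_zero, LinearMap.id_apply]
    rw [show Finsupp.linearCombination (R ⧸ J) id (s (q x.1)) = q x.1 from
      LinearMap.congr_fun hs (q x.1), sub_self]
  refine Module.Projective.of_split i (φ.codRestrict N hφ) (LinearMap.ext fun n ↦ Subtype.ext ?_)
  simp only [LinearMap.comp_apply, LinearMap.codRestrict_apply, φ, LinearMap.coprod_apply, hιi,
    LinearMap.sub_apply, LinearMap.id_apply]
  exact sub_add_cancel _ _

/-- Descent along `I + J^k`, from `R` at `k = 0` to `I` at `k = n`: since `J (I + J^k) ⊆ I +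
J^(k+1)`, each step is an instance of `Submodule.projective_of_smul_mem`. -/
theorem Ideal.projective_of_pow_le (J : Ideal R) [J.IsTwoSided] [IsSemisimpleRing (R ⧸ J)]
    [Module.Projective R J] {I : Ideal R} {n : ℕ} (h : J ^ n ≤ I) : Module.Projective R I := by
  suffices ∀ k, Module.Projective R ↥(I ⊔ J ^ k) by
    have := this n
    rwa [sup_eq_left.mpr h] at this
  intro k
  induction k with
  | zero =>
    rw [Submodule.pow_zero, Ideal.one_eq_top, sup_top_eq]
    exact Module.Projective.of_equiv' Submodule.topEquiv.symm
  | succ k ih =>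
    have hle : I ⊔ J ^ (k + 1) ≤ I ⊔ J ^ k := sup_le_sup_left (Ideal.pow_le_pow_right k.le_succ) _
    have := Submodule.projective_of_smul_mem J (Submodule.comap (I ⊔ J ^ k).subtype (I ⊔ J ^ (k + 1)))
      fun j hj m ↦ by
        rw [Submodule.mem_comap]
        obtain ⟨a, ha, b, hb, hab⟩ := Submodule.mem_sup.mp m.2
        change j * (m : R) ∈ _
        rw [← hab, mul_add]
        refine Submodule.add_mem_sup (I.mul_mem_left _ ha) ?_
        rw [Ideal.IsTwoSided.pow_succ]
        exact Ideal.mul_mem_mul hj hb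
    exact Module.Projective.of_equiv' (Submodule.comapSubtypeEquivOfLe hle)

theorem Ideal.projective_of_inf_eq_bot (J : Ideal R) [J.IsTwoSided] [IsSemisimpleRing (R ⧸ J)]
    [Module.Projective R J] {I I' : Ideal R} (hI : I ⊓ I' = ⊥) {n : ℕ} (h : J ^ n ≤ I ⊔ I') :
    Module.Projective R I := by
  have := Ideal.projective_of_pow_le J h
  let e : (I × I') →ₗ[R] ↥(I ⊔ I') :=
    (Submodule.inclusion le_sup_left).coprod (Submodule.inclusion le_sup_right)
  have he : Function.Bijective e := by
    refine ⟨(injective_iff_map_eq_zero _).mpr fun x hx ↦ ?_, fun y ↦ ?_⟩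
    · have hx' : (x.1 : R) + x.2 = 0 := congrArg Subtype.val hx
      have h1 : (x.1 : R) ∈ I ⊓ I' :=
        ⟨x.1.2, by rw [eq_neg_of_add_eq_zero_left hx']; exact neg_mem x.2.2⟩
      rw [hI, Submodule.mem_bot] at h1
      rw [h1, zero_add] at hx'
      exact Prod.ext (Subtype.ext h1) (Subtype.ext hx')
    · obtain ⟨a, ha, b, hb, hab⟩ := Submodule.mem_sup.mp y.2
      exact ⟨(⟨a, ha⟩, ⟨b, hb⟩), Subtype.ext hab⟩
  have := Module.Projective.of_equiv' (LinearEquiv.ofBijective e he).symm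
  exact Module.Projective.of_split (LinearMap.inl R I I') (LinearMap.fst R I I') (by ext; rfl)

theorem Ideal.pow_succ_induction_on {J : Ideal R} {n : ℕ} {p : R → Prop} {x : R}
    (hx : x ∈ J ^ (n + 1)) (mul : ∀ a ∈ J ^ n, ∀ b ∈ J, p (a * b))
    (add : ∀ a b, p a → p b → p (a + b)) : p x := by
  rw [Submodule.pow_succ, ← smul_eq_mul] at hx
  exact Submodule.smul_induction_on hx mul add

/-- The dual basis lemma for left ideals. -/
theorem Ideal.projective_of_sum_eq {I : Ideal R} {ι : Type*} [Fintype ι] (φ : ι → I →ₗ[R] R)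
    (e : ι → I) (h : ∀ x : I, ∑ i, φ i x * e i = (x : R)) : Module.Projective R I := by
  refine Module.Projective.of_split (LinearMap.pi φ)
    (Fintype.linearCombination R e) (LinearMap.ext fun x ↦ Subtype.ext ?_)
  simp [Fintype.linearCombination_apply, ← h x]

/-- The dual basis lemma for a left ideal of an order, in terms of right multiplications by elements
of the ambient algebra. -/
theorem Ideal.projective_of_sum_mul_eq_one {S B : Type*} [CommRing S] [Ring B] [Algebra S B]
    {A : Subalgebra S B} {I : Ideal A} {ι : Type*} [Fintype ι] (y : ι → B) (e : ι → I)
    (hy : ∀ (i : ι) (x : I), ((x : A) : B) * y i ∈ A) (h : ∑ i, y i * ((e i : A) : B) = 1) :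
    Module.Projective A I := by
  let φ (i : ι) : I →ₗ[A] A :=
    { toFun := fun x ↦ ⟨((x : A) : B) * y i, hy i x⟩
      map_add' := fun x x' ↦ Subtype.ext (add_mul _ _ _)
      map_smul' := fun a x ↦ Subtype.ext (mul_assoc _ _ _) }
  refine Ideal.projective_of_sum_eq φ e fun x ↦ Subtype.ext ?_
  rw [AddSubmonoidClass.coe_finsetSum]
  change ∑ i, ((x : A) : B) * y i * ((e i : A) : B) = _
  simp only [mul_assoc]
  rw [← Finset.mul_sum, h, mul_one]

/-- `y` and `z` are the coordinates of `p` and `x` under a section of the free cover of the ideal;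
linearity and `x p = p x` give `x y_i = p z_i`. -/
theorem Ideal.exists_sum_eq_of_projective_span_pair {p x : R} (hpx : x * p = p * x)
    [Module.Projective R (Ideal.span {p, x})] :
    ∃ (s : Finset (Ideal.span {p, x})) (y z : Ideal.span {p, x} → R),
      p = ∑ i ∈ s, y i * i ∧ ∀ i, x * y i = p * z i := by
  obtain ⟨s, hs⟩ := Module.projective_def'.mp ‹Module.Projective R (Ideal.span {p, x})›
  let p' : Ideal.span {p, x} := ⟨p, Ideal.subset_span (by simp)⟩
  let x' : Ideal.span {p, x} := ⟨x, Ideal.subset_span (by simp)⟩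
  refine ⟨(s p').support, s p', s x', ?_, fun i ↦ ?_⟩
  · have := congrArg Subtype.val (LinearMap.congr_fun hs p')
    simpa [Finsupp.linearCombination_apply, Finsupp.sum, p'] using this.symm
  · have h1 : x • s p' = p • s x' := by
      rw [← map_smul, ← map_smul]
      exact congrArg s (Subtype.ext hpx)
    exact DFunLike.congr_fun h1 i

theorem isSemisimpleRing_of_forall_jacobson [IsArtinianRing R]
    (h : ∀ x ∈ Ring.jacobson R, x = 0) : IsSemisimpleRing R :=
  IsArtinianRing.isSemisimpleRing_iff_jacobson.mpr ((Submodule.eq_bot_iff _).mpr h)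

theorem isNilpotent_of_mem_jacobson [IsArtinianRing R] {x : R} (hx : x ∈ Ring.jacobson R) :
    IsNilpotent x := by
  obtain ⟨n, hn⟩ := IsSemiprimaryRing.isNilpotent (R := R)
  refine ⟨n, ?_⟩
  have := Ideal.pow_mem_pow hx n
  rw [hn] at this
  exact this

end RingTheory

/-! ### Coordinates and products in the crossed product. -/

section CrossedProduct

variable {E K : Type*} [Field E] [Field K] [Algebra E K]

namespace NormalizedTwoCocycle

theorem val_ne_zero (f : NormalizedTwoCocycle E K) (σ τ : Gal(K/E)) : f.val σ τ ≠ 0 :=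
  (f.toFun (σ, τ)).ne_zero

/-- The cocycle identity in terms of the pairs `(σ, τ)`, `(τ, ρ)`, `(σ, ρ)`, the form suited to the
relation `UnitRel`. -/
theorem val_mul_inv_mul (f : NormalizedTwoCocycle E K) (σ τ ρ : Gal(K/E)) :
    f.val τ (τ⁻¹ * ρ) * f.val σ (σ⁻¹ * τ) = σ (f.val (σ⁻¹ * τ) (τ⁻¹ * ρ)) * f.val σ (σ⁻¹ * ρ) := by
  have := f.val_cocycle σ (σ⁻¹ * τ) (τ⁻¹ * ρ)
  simpa [mul_assoc] using this

end NormalizedTwoCocycle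

namespace CrossedProduct

variable {f : NormalizedTwoCocycle E K}

@[ext]
theorem ext {x y : CrossedProduct f} (h : ∀ σ, x.coeff σ = y.coeff σ) : x = y :=
  Finsupp.ext h

theorem coeff_single_self (σ : Gal(K/E)) (a : K) : (single f σ a).coeff σ = a := by
  classical
  rw [coeff_single, if_pos rfl]

theorem coeff_single_of_ne {σ τ : Gal(K/E)} (h : σ ≠ τ) (a : K) :
    (single f σ a).coeff τ = 0 := by
  classical
  rw [coeff_single, if_neg h]

/-- The coordinate at `x_σ`, as an additive map. -/
noncomputable def coeffHom (σ : Gal(K/E)) : CrossedProduct f →+ K where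
  toFun x := x.coeff σ
  map_zero' := coeff_zero σ
  map_add' x y := coeff_add x y σ

theorem coeff_sum {ι : Type*} (s : Finset ι) (x : ι → CrossedProduct f) (σ : Gal(K/E)) :
    (∑ i ∈ s, x i).coeff σ = ∑ i ∈ s, (x i).coeff σ :=
  map_sum (coeffHom σ) x s

theorem single_mul_one_single (σ : Gal(K/E)) (a b : K) :
    single f 1 a * single f σ b = single f σ (a * b) := by
  simp [single_mul_single, f.val_one_left]

variable [FiniteDimensional E K]

theorem sum_single (x : CrossedProduct f) : ∑ σ, single f σ (x.coeff σ) = x := by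
  ext ρ
  rw [coeff_sum, Finset.sum_eq_single ρ, coeff_single_self]
  · exact fun σ _ h ↦ coeff_single_of_ne h _
  · simp

theorem coeff_single_mul (σ ρ : Gal(K/E)) (a : K) (y : CrossedProduct f) :
    (single f σ a * y).coeff ρ = a * σ (y.coeff (σ⁻¹ * ρ)) * f.val σ (σ⁻¹ * ρ) := by
  conv_lhs => rw [← sum_single y]
  simp only [Finset.mul_sum, single_mul_single]
  rw [coeff_sum, Finset.sum_eq_single (σ⁻¹ * ρ)]
  · rw [mul_inv_cancel_left, coeff_single_self]
  · intro τ _ h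
    refine coeff_single_of_ne (fun e ↦ h ?_) _
    rw [← e, inv_mul_cancel_left]
  · simp

theorem coeff_mul (x y : CrossedProduct f) (ρ : Gal(K/E)) :
    (x * y).coeff ρ = ∑ σ, x.coeff σ * σ (y.coeff (σ⁻¹ * ρ)) * f.val σ (σ⁻¹ * ρ) := by
  conv_lhs => rw [← sum_single x]
  simp only [Finset.sum_mul, coeff_sum, coeff_single_mul]

theorem coeff_mul_single (σ ρ : Gal(K/E)) (a : K) (x : CrossedProduct f) :
    (x * single f σ a).coeff ρ =
      x.coeff (ρ * σ⁻¹) * (ρ * σ⁻¹) a * f.val (ρ * σ⁻¹) σ := by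
  rw [coeff_mul, Finset.sum_eq_single (ρ * σ⁻¹)]
  · have h : (ρ * σ⁻¹)⁻¹ * ρ = σ := by group
    rw [h, coeff_single_self]
  · intro τ _ h
    rw [coeff_single_of_ne, map_zero, mul_zero, zero_mul]
    rintro rfl
    exact h (by group)
  · simp

theorem coeff_algebraMap_mul (e : E) (x : CrossedProduct f) (σ : Gal(K/E)) :
    (algebraMap E (CrossedProduct f) e * x).coeff σ = algebraMap E K e * x.coeff σ := by
  rw [algebraMap_def, coeff_single_mul]
  simp [f.val_one_left]

theorem coeff_smul (e : E) (x : CrossedProduct f) (σ : Gal(K/E)) :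
    (e • x).coeff σ = algebraMap E K e * x.coeff σ := by
  rw [Algebra.smul_def, coeff_algebraMap_mul]

/-- The dual families isolate one homogeneous component by two-sided multiplications, so two-sided
ideals are homogeneous: the coordinate at `ρ` is multiplied by `∑ a_i (ρσ⁻¹)(b_i)`, which vanishes
unless `ρ = σ`. -/
theorem sum_dual_mul_mul {n : ℕ} {a b : Fin n → K} (h1 : ∑ i, a i * b i = 1)
    (h0 : ∀ σ : Gal(K/E), σ ≠ 1 → ∑ i, a i * σ (b i) = 0) (x : CrossedProduct f) (σ : Gal(K/E)) :
    ∑ i, single f 1 (a i) * x * single f 1 (σ⁻¹ (b i)) = single f σ (x.coeff σ) := by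
  ext ρ
  have key : (∑ i, single f 1 (a i) * x * single f 1 (σ⁻¹ (b i))).coeff ρ =
      x.coeff ρ * ∑ i, a i * (ρ * σ⁻¹) (b i) := by
    rw [coeff_sum, Finset.mul_sum]
    refine Finset.sum_congr rfl fun i _ ↦ ?_
    rw [coeff_mul_single, coeff_single_mul]
    simp [f.val_one_left, f.val_one_right]
    ring
  rw [key]
  rcases eq_or_ne σ ρ with rfl | h
  · rw [mul_inv_cancel, coeff_single_self]
    simp [h1]
  · rw [h0, coeff_single_of_ne h, mul_zero]
    exact fun e ↦ h (mul_inv_eq_one.mp e).symm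

end CrossedProduct

end CrossedProduct

theorem eq_one_of_mul_eq_one_of_le {Γ : Type*} [LinearOrderedCommGroupWithZero Γ] {a b : Γ}
    (ha : a ≤ 1) (hb : b ≤ 1) (h : a * b = 1) : a = 1 ∧ b = 1 := by
  constructor
  · exact ha.antisymm (h ▸ mul_le_of_le_one_right' hb)
  · exact hb.antisymm (h ▸ mul_le_of_le_one_left' ha)

/-! ### The preorder on the group attached to a place. -/

section UnitRel

variable {E K : Type*} [Field E] [Field K] [Algebra E K] {V : ValuationSubring E}
  {f : NormalizedTwoCocycle E K}

namespace NormalizedTwoCocycle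

/-- `f(σ, σ⁻¹τ)` is a unit of `W`. -/
def UnitRel (f : NormalizedTwoCocycle E K) (W : ValuationSubring K) (σ τ : Gal(K/E)) : Prop :=
  W.valuation (f.val σ (σ⁻¹ * τ)) = 1

variable {W : ValuationSubring K}

theorem unitRel_refl (σ : Gal(K/E)) : f.UnitRel W σ σ := by
  simp [UnitRel, f.val_one_right]

theorem unitRel_one (σ : Gal(K/E)) : f.UnitRel W 1 σ := by
  simp [UnitRel, f.val_one_left]

theorem unitRel_one_right (σ : Gal(K/E)) : f.UnitRel W σ 1 ↔ W.valuation (f.val σ σ⁻¹) = 1 := by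
  simp [UnitRel]

variable (hf : f.IsIntegralOver V) (hW : W ∈ placesOver V K)
include hf hW

theorem IsIntegralOver.valuation_le_one (σ τ : Gal(K/E)) : W.valuation (f.val σ τ) ≤ 1 :=
  valuation_le_one_of_mem_integralClosure hW (hf σ τ)

theorem IsIntegralOver.valuation_apply_le_one (ρ σ τ : Gal(K/E)) :
    W.valuation (ρ (f.val σ τ)) ≤ 1 :=
  valuation_le_one_of_mem_integralClosure hW (map_mem_integralClosure V ρ (hf σ τ))

/-- In `val_mul_inv_mul` all factors are integral, so if the left side is a unit, both factors on
the right are units. -/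
theorem IsIntegralOver.unitRel_trans {σ τ ρ : Gal(K/E)} (h1 : f.UnitRel W σ τ)
    (h2 : f.UnitRel W τ ρ) : f.UnitRel W σ ρ := by
  have := congrArg W.valuation (f.val_mul_inv_mul σ τ ρ)
  rw [map_mul, map_mul, h1, h2, one_mul] at this
  exact (eq_one_of_mul_eq_one_of_le (hf.valuation_apply_le_one hW _ _ _)
    (hf.valuation_le_one hW _ _) this.symm).2

omit hf hW in
theorem unitRel_comap (σ τ ρ : Gal(K/E)) : f.UnitRel (W.comap (σ : K →+* K)) (σ⁻¹ * τ) (σ⁻¹ * ρ) ↔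
    W.valuation (σ (f.val (σ⁻¹ * τ) (τ⁻¹ * ρ))) = 1 := by
  have h : (σ⁻¹ * τ)⁻¹ * (σ⁻¹ * ρ) = τ⁻¹ * ρ := by group
  rw [UnitRel, ValuationSubring.valuation_comap_eq_one_iff, h]
  rfl

/-- Equivalence of `σ` and `τ` at `W` becomes `σ⁻¹τ ≤ 1` at the conjugate place: `f(σ, σ⁻¹τ) f(τ,
τ⁻¹σ)` is the image under `σ` of `f(σ⁻¹τ, τ⁻¹σ)`. -/
theorem IsIntegralOver.unitRel_comap_iff {σ τ : Gal(K/E)} :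
    f.UnitRel (W.comap (σ : K →+* K)) (σ⁻¹ * τ) 1 ↔ f.UnitRel W σ τ ∧ f.UnitRel W τ σ := by
  have := congrArg W.valuation (f.val_mul_inv_mul σ τ σ)
  rw [map_mul, map_mul, inv_mul_cancel σ, f.val_one_right, map_one, mul_one] at this
  have h := unitRel_comap (f := f) (W := W) σ τ σ
  rw [inv_mul_cancel] at h
  rw [h, ← this]
  refine ⟨fun h ↦ (eq_one_of_mul_eq_one_of_le (hf.valuation_le_one hW _ _)
    (hf.valuation_le_one hW _ _) h).symm, fun h ↦ ?_⟩
  rw [show W.valuation _ = 1 from h.1, show W.valuation _ = 1 from h.2, one_mul]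

end NormalizedTwoCocycle

end UnitRel

/-! ### Hereditary implies the squarefree criterion. -/

section Necessity

variable {E K : Type*} [Field E] [Field K] [Algebra E K] {V : ValuationSubring E}
  {f : NormalizedTwoCocycle E K} {W : ValuationSubring K}

theorem valuation_le_one_of_mem_crossedProductOrder {hf : f.IsIntegralOver V}
    (hW : W ∈ placesOver V K) {x : CrossedProduct f} (hx : x ∈ crossedProductOrder V f hf)
    (ρ σ : Gal(K/E)) : W.valuation (ρ (x.coeff σ)) ≤ 1 :=
  valuation_le_one_of_mem_integralClosure hW (map_mem_integralClosure V ρ (hx σ))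

theorem single_mem_crossedProductOrder (hf : f.IsIntegralOver V) (σ : Gal(K/E)) {a : K}
    (ha : a ∈ integralClosure V K) : CrossedProduct.single f σ a ∈ crossedProductOrder V f hf := by
  classical
  intro τ
  rw [CrossedProduct.coeff_single]
  split_ifs
  exacts [ha, zero_mem _]

theorem IsUnramifiedUniformizer.mem {π : E} (hπ : IsUnramifiedUniformizer V K π) : π ∈ V :=
  (V.valuation_le_one_iff π).mp hπ.valuation_lt_one.le

theorem IsUnramifiedUniformizer.mem_integralClosure {π : E} (hπ : IsUnramifiedUniformizer V K π) :
    algebraMap E K π ∈ integralClosure V K :=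
  (integralClosure V K).algebraMap_mem ⟨π, hπ.mem⟩

theorem IsUnramifiedUniformizer.valuation_pos {π : E} (hπ : IsUnramifiedUniformizer V K π)
    (W : ValuationSubring K) : 0 < W.valuation (algebraMap E K π) :=
  zero_lt_iff.mpr ((Valuation.ne_zero_iff _).mpr
    ((map_ne_zero (algebraMap E K)).mpr hπ.ne_zero))

open CrossedProduct

/-- This bounds one term of the `x_1`-coordinate of `y i`, where `i` lies in the left ideal
generated by `π` and `x_τ`. Each case below supplies two factors `π`. -/
theorem valuation_mul_mul_le {π : E} (hπ : IsUnramifiedUniformizer V K π)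
    (hf : f.IsIntegralOver V) (hW : W ∈ placesOver V K) {σ τ : Gal(K/E)}
    (hτ : W.valuation (f.val τ⁻¹ τ) ≤ W.valuation (algebraMap E K π) ^ 2) {y z p q : K}
    (hy : W.valuation y ≤ 1) (hz : W.valuation (τ⁻¹ z) ≤ 1) (hp : W.valuation (σ p) ≤ 1)
    (hq : W.valuation (σ q) ≤ 1) (hyz : τ y * f.val τ σ = algebraMap E K π * z) :
    W.valuation (y * σ (p * algebraMap E K π + q * f.val (σ⁻¹ * τ⁻¹) τ) * f.val σ σ⁻¹) ≤
      W.valuation (algebraMap E K π) ^ 2 := by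
  have hc : W.valuation (σ (p * algebraMap E K π + q * f.val (σ⁻¹ * τ⁻¹) τ)) ≤ 1 := by
    rw [map_add, map_mul, map_mul, AlgEquiv.commutes]
    refine (Valuation.map_add _ _ _).trans (max_le ?_ ?_) <;> rw [map_mul]
    · exact mul_le_one' hp (valuation_le_one_of_mem_integralClosure hW hπ.mem_integralClosure)
    · exact mul_le_one' hq (hf.valuation_apply_le_one hW _ _ _)
  have hff := hf.valuation_le_one hW σ σ⁻¹
  rw [map_mul, map_mul]
  rcases (hf.valuation_apply_le_one hW σ (σ⁻¹ * τ⁻¹) τ).lt_or_eq with hlt | h1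
  -- The middle factor gives one `π`. The other comes from `f(σ, σ⁻¹)` if that is a non-unit;
  -- otherwise `τ⁻¹(f(τ, σ))` is a unit and `hyz` makes `y` divisible by `π`.
  · have hc' : W.valuation (σ (p * algebraMap E K π + q * f.val (σ⁻¹ * τ⁻¹) τ)) ≤
        W.valuation (algebraMap E K π) := by
      rw [map_add, map_mul, map_mul, AlgEquiv.commutes]
      refine (Valuation.map_add _ _ _).trans (max_le ?_ ?_) <;> rw [map_mul]
      · exact mul_le_of_le_one_left' hp
      · exact (mul_le_of_le_one_left' hq).trans (hπ.valuation_le W hW _ hlt)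
    rcases hff.lt_or_eq with hlt' | h1'
    · calc _ ≤ 1 * W.valuation (algebraMap E K π) * W.valuation (algebraMap E K π) := by
            gcongr
            exact hπ.valuation_le W hW _ hlt'
        _ = _ := by rw [one_mul, sq]
    · have h2 : W.valuation (τ⁻¹ (f.val τ σ)) = 1 := by
        have := congrArg (fun t ↦ W.valuation (τ⁻¹ t)) (f.val_cocycle τ σ σ⁻¹)
        simp only [map_mul, mul_inv_cancel, f.val_one_right, mul_one] at this
        rw [show τ⁻¹ (τ (f.val σ σ⁻¹)) = f.val σ σ⁻¹ from τ.symm_apply_apply _, h1'] at this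
        exact (eq_one_of_mul_eq_one_of_le (hf.valuation_apply_le_one hW _ _ _)
          (hf.valuation_apply_le_one hW _ _ _) this).2
      have hy' : W.valuation y ≤ W.valuation (algebraMap E K π) := by
        have := congrArg (fun t ↦ W.valuation (τ⁻¹ t)) hyz
        simp only [map_mul, AlgEquiv.commutes] at this
        rw [show τ⁻¹ (τ y) = y from τ.symm_apply_apply _, h2, mul_one] at this
        rw [this]
        exact mul_le_of_le_one_right' hz
      rw [h1', mul_one, sq]
      gcongr
  -- Here `σ(f(σ⁻¹, τ⁻¹))` has the valuation of `f(τ⁻¹, τ)`, and it divides `f(σ, σ⁻¹)`, which alone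
  -- supplies `π²`.
  · have h2 : W.valuation (σ (f.val σ⁻¹ τ⁻¹)) = W.valuation (f.val τ⁻¹ τ) := by
      have := congrArg (fun t ↦ W.valuation (σ t)) (f.val_cocycle σ⁻¹ τ⁻¹ τ)
      simp only [map_mul, h1, one_mul, inv_mul_cancel, f.val_one_right, mul_one] at this
      rw [this, show σ (σ⁻¹ (f.val τ⁻¹ τ)) = f.val τ⁻¹ τ from σ.apply_symm_apply _]
    have h3 : W.valuation (f.val σ σ⁻¹) ≤ W.valuation (algebraMap E K π) ^ 2 := by
      have := congrArg W.valuation (f.val_cocycle σ σ⁻¹ τ⁻¹)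
      rw [map_mul, map_mul, mul_inv_cancel, f.val_one_left, map_one, one_mul, h2] at this
      rw [this]
      exact (mul_le_of_le_one_right' (hf.valuation_le_one hW _ _)).trans hτ
    exact (mul_le_of_le_one_left' (mul_le_one' hy hc)).trans h3

variable [FiniteDimensional E K]

/-- Otherwise the left ideal generated by `π` and `x_τ`, being projective, gives `π = ∑ y_i i`, in
which every `x_1`-coordinate on the right has valuation at most that of `π²`. -/
theorem lt_valuation_val_inv_of_projective {π : E} (hπ : IsUnramifiedUniformizer V K π)
    (hf : f.IsIntegralOver V)
    (hA : ∀ I : Submodule (crossedProductOrder V f hf) (crossedProductOrder V f hf),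
      Module.Projective (crossedProductOrder V f hf) I)
    (hW : W ∈ placesOver V K) (τ : Gal(K/E)) :
    W.valuation (algebraMap E K π) ^ 2 < W.valuation (f.val τ⁻¹ τ) := by
  by_contra! hτ
  let P : crossedProductOrder V f hf :=
    ⟨single f 1 (algebraMap E K π), single_mem_crossedProductOrder hf 1 hπ.mem_integralClosure⟩
  let X : crossedProductOrder V f hf :=
    ⟨single f τ 1, single_mem_crossedProductOrder hf τ (one_mem _)⟩
  let I : Ideal (crossedProductOrder V f hf) := Ideal.span {P, X}
  have hPX : X * P = P * X := Subtype.ext (by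
    simp [P, X, single_mul_single, f.val_one_left, f.val_one_right])
  have := hA I
  obtain ⟨t, y, z, hsum, hXy⟩ := Ideal.exists_sum_eq_of_projective_span_pair hPX
  have hle (i : I) (σ : Gal(K/E)) :
      W.valuation ((y i : CrossedProduct f).coeff σ *
        σ (((i : crossedProductOrder V f hf) : CrossedProduct f).coeff (σ⁻¹ * 1)) *
          f.val σ (σ⁻¹ * 1)) ≤ W.valuation (algebraMap E K π) ^ 2 := by
    obtain ⟨p, q, hpq⟩ := Ideal.mem_span_pair.mp i.2
    have hi : ((i : crossedProductOrder V f hf) : CrossedProduct f).coeff σ⁻¹ =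
        (p : CrossedProduct f).coeff σ⁻¹ * algebraMap E K π +
          (q : CrossedProduct f).coeff (σ⁻¹ * τ⁻¹) * f.val (σ⁻¹ * τ⁻¹) τ := by
      rw [← hpq]
      change ((p : CrossedProduct f) * single f 1 (algebraMap E K π) +
        (q : CrossedProduct f) * single f τ 1).coeff σ⁻¹ = _
      rw [coeff_add, coeff_mul_single, coeff_mul_single]
      simp [f.val_one_right]
    rw [mul_one, hi]
    have hyz := congrArg (fun t : crossedProductOrder V f hf ↦
      (t : CrossedProduct f).coeff (τ * σ)) (hXy i)
    have hyz' : (single f τ 1 * (y i : CrossedProduct f)).coeff (τ * σ) =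
      (single f 1 (algebraMap E K π) * (z i : CrossedProduct f)).coeff (τ * σ) := hyz
    rw [coeff_single_mul, coeff_single_mul, inv_mul_cancel_left, f.val_one_left, one_mul,
      mul_one, inv_one, one_mul, AlgEquiv.one_apply] at hyz'
    refine valuation_mul_mul_le hπ hf hW hτ ?_ ?_ ?_ ?_ hyz'
    · exact valuation_le_one_of_mem_crossedProductOrder hW (y i).2 1 σ
    · exact valuation_le_one_of_mem_crossedProductOrder hW (z i).2 _ _
    · exact valuation_le_one_of_mem_crossedProductOrder hW p.2 _ _
    · exact valuation_le_one_of_mem_crossedProductOrder hW q.2 _ _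
  replace hsum : algebraMap E K π = ∑ i ∈ t, ((y i : CrossedProduct f) *
      ((i : crossedProductOrder V f hf) : CrossedProduct f)).coeff 1 := by
    rw [← coeff_sum, ← coeff_single_self (f := f) 1 (algebraMap E K π)]
    refine congrArg (fun t : CrossedProduct f ↦ t.coeff 1)
      ((congrArg (crossedProductOrder V f hf).val hsum).trans ?_)
    rw [map_sum]
    rfl
  have hfin : W.valuation (algebraMap E K π) ≤ W.valuation (algebraMap E K π) ^ 2 := by
    conv_lhs => rw [hsum]
    refine Valuation.map_sum_le _ fun i _ ↦ ?_
    rw [coeff_mul]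
    exact Valuation.map_sum_le _ fun σ _ ↦ hle i σ
  rw [sq] at hfin
  exact hfin.not_gt (mul_lt_of_lt_one_right (hπ.valuation_pos W)
    ((valuation_algebraMap_lt_one_iff hW).mpr hπ.valuation_lt_one))

end Necessity

theorem isArtinian_of_isTorsionBySet {R M : Type*} [CommRing R] [AddCommGroup M] [Module R M]
    [Module.Finite R M] (m : Ideal R) [m.IsMaximal] (h : Module.IsTorsionBySet R M m) :
    IsArtinian R M := by
  let := h.module
  let := Ideal.Quotient.field m
  have : Module.Finite (R ⧸ m) M := Module.Finite.of_restrictScalars_finite R (R ⧸ m) M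
  have : IsArtinian (R ⧸ m) M := inferInstance
  exact isArtinian_of_surjective_algebraMap (R := R ⧸ m) Ideal.Quotient.mk_surjective

/-! ### The crossed product is an order. -/

section Order

variable {E K : Type*} [Field E] [Field K] [Algebra E K] {V : ValuationSubring E}
  {f : NormalizedTwoCocycle E K} {π : E}

open CrossedProduct

theorem IsUnramifiedUniformizer.exists_mem_placesOver (hπ : IsUnramifiedUniformizer V K π) :
    ∃ W, W ∈ placesOver V K := by
  refine _root_.exists_mem_placesOver (e := π⁻¹) ?_
  have := (V.valuation_lt_one_iff_inv π).mp hπ.valuation_lt_one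
  exact this.resolve_left hπ.ne_zero

theorem IsUnramifiedUniformizer.exists_eq_mul {x : K} (hπ : IsUnramifiedUniformizer V K π)
    (hx : ∀ W ∈ placesOver V K, W.valuation x < 1) :
    ∃ y ∈ integralClosure V K, x = algebraMap E K π * y := by
  have h0 : algebraMap E K π ≠ 0 := (map_ne_zero _).mpr hπ.ne_zero
  refine ⟨x / algebraMap E K π, mem_integralClosure_iff_forall_mem.mpr fun W hW ↦ ?_,
    (mul_div_cancel₀ x h0).symm⟩
  rw [← W.valuation_le_iff_div_mem _ h0]
  exact hπ.valuation_le W hW x (hx W hW)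

variable [FiniteDimensional E K] [IsGalois E K]

/-- The trace expansion shows directly that the `a_i` generate the integral closure, which applies
over `U` as well. -/
theorem IsUnramifiedUniformizer.exists_sum_eq (hπ : IsUnramifiedUniformizer V K π) :
    ∃ (n : ℕ) (a : Fin n → K), (∀ i, a i ∈ integralClosure V K) ∧
      ∀ x ∈ integralClosure V K, ∃ v : Fin n → V, x = ∑ i, a i * algebraMap E K (v i) := by
  obtain ⟨n, a, b, ha, hb, h1, h0⟩ := hπ.dual
  refine ⟨n, a, ha, fun x hx ↦ ?_⟩
  have key (i : Fin n) : ∃ v : V, ∑ σ : Gal(K/E), σ (b i * x) = algebraMap E K v := by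
    have hmem : ∑ σ : Gal(K/E), σ (b i * x) ∈ integralClosure V K :=
      sum_mem fun σ _ ↦ map_mem_integralClosure V σ (mul_mem (hb i) hx)
    obtain ⟨e, he⟩ := (IsGalois.mem_range_algebraMap_iff_fixed
      (∑ σ : Gal(K/E), σ (b i * x))).mpr fun τ ↦ by
        rw [map_sum]
        exact Fintype.sum_equiv (Equiv.mulLeft τ) _ _ fun σ ↦ rfl
    rw [← he] at hmem
    exact ⟨⟨e, algebraMap_mem_integralClosure_iff.mp hmem⟩, he.symm⟩
  choose v hv using key
  refine ⟨v, ?_⟩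
  rw [← sum_mul_sum_dual h1 h0 x]
  simp only [hv]

theorem crossedProductOrder_fg (hπ : IsUnramifiedUniformizer V K π) (hf : f.IsIntegralOver V) :
    (Subalgebra.toSubmodule (crossedProductOrder V f hf)).FG := by
  obtain ⟨n, a, ha, h⟩ := hπ.exists_sum_eq
  refine Submodule.fg_def.mpr ⟨Set.range fun p : Gal(K/E) × Fin n ↦ single f p.1 (a p.2),
    Set.finite_range _, le_antisymm (Submodule.span_le.mpr ?_) fun x hx ↦ ?_⟩
  · rintro _ ⟨p, rfl⟩
    exact single_mem_crossedProductOrder hf _ (ha _)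
  · rw [← sum_single x]
    refine sum_mem fun σ _ ↦ ?_
    obtain ⟨v, hv⟩ := h _ (hx σ)
    have : single f σ (x.coeff σ) = ∑ i, v i • single f σ (a i) := by
      rw [hv]
      ext τ
      rw [coeff_sum]
      have (i : Fin n) : (v i • single f σ (a i)).coeff τ =
          algebraMap E K (v i) * (single f σ (a i)).coeff τ := coeff_smul _ _ _
      simp only [this]
      rcases eq_or_ne σ τ with rfl | hne
      · simp only [coeff_single_self, mul_comm]
      · simp only [coeff_single_of_ne hne, mul_zero, Finset.sum_const_zero]
    rw [this]
    exact sum_mem fun i _ ↦ Submodule.smul_mem _ _ (Submodule.subset_span ⟨(σ, i), rfl⟩)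

theorem isOrderIn_crossedProductOrder (hπ : IsUnramifiedUniformizer V K π)
    (hf : f.IsIntegralOver V) : IsOrderIn V (crossedProductOrder V f hf) where
  fg := crossedProductOrder_fg hπ hf
  span_eq_top := by
    refine Submodule.eq_top_iff'.mpr fun x ↦ ?_
    rw [← sum_single x]
    refine sum_mem fun σ _ ↦ ?_
    obtain ⟨k, hk⟩ := hπ.exists_pow_mul_mem (x.coeff σ)
    have h0 : π ^ k ≠ 0 := pow_ne_zero _ hπ.ne_zero
    rw [← Submodule.smul_mem_iff _ h0]
    refine Submodule.subset_span ?_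
    have : π ^ k • single f σ (x.coeff σ) = single f σ (algebraMap E K π ^ k * x.coeff σ) := by
      rw [Algebra.smul_def, algebraMap_def, single_mul_one_single, map_pow]
    rw [this]
    exact single_mem_crossedProductOrder hf σ hk

end Order

/-! ### The ideal `J` that serves as the radical. -/

section Radical

variable {E K : Type*} [Field E] [Field K] [Algebra E K] [FiniteDimensional E K]
  {V : ValuationSubring E} {f : NormalizedTwoCocycle E K} {π : E}

open CrossedProduct NormalizedTwoCocycle

theorem CrossedProduct.valuation_coeff_mul_lt_one {W : ValuationSubring K} {x y : CrossedProduct f}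
    {ρ : Gal(K/E)} (h : ∀ σ, W.valuation (x.coeff σ) * W.valuation (σ (y.coeff (σ⁻¹ * ρ))) *
      W.valuation (f.val σ (σ⁻¹ * ρ)) < 1) : W.valuation ((x * y).coeff ρ) < 1 := by
  rw [coeff_mul]
  refine Valuation.map_sum_lt _ one_ne_zero fun σ _ ↦ ?_
  rw [map_mul, map_mul]
  exact h σ

variable (V f) in
/-- The elements `∑ c_σ x_σ` such that `c_σ` is a non-unit at each place where `f(σ, σ⁻¹)` is a
unit. -/
def NonunitAtUnits (x : CrossedProduct f) : Prop :=
  ∀ σ, ∀ W ∈ placesOver V K, f.UnitRel W σ 1 → W.valuation (x.coeff σ) < 1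

theorem mul_lt_one_of_le_of_imp {Γ : Type*} [LinearOrderedCommGroupWithZero Γ] {a b c : Γ}
    (ha : a ≤ 1) (hb : b ≤ 1) (hc : c ≤ 1) (h : c = 1 → a < 1 ∨ b < 1) : a * b * c < 1 := by
  rcases hc.lt_or_eq with hlt | h1
  · exact mul_lt_one_of_nonneg_of_lt_one_right (mul_le_one' ha hb) zero_le hlt
  · rw [h1, mul_one]
    rcases h h1 with h | h
    · exact mul_lt_one_of_nonneg_of_lt_one_left zero_le h hb
    · exact mul_lt_one_of_nonneg_of_lt_one_right ha zero_le h

variable (hf : f.IsIntegralOver V)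
include hf

/-- In the coordinate at `ρ ≤ 1`, a term with `f(σ, σ⁻¹ρ)` a unit has `σ ≤ ρ ≤ 1`, so the factor
from `x` is a non-unit. -/
theorem NonunitAtUnits.mul_right {x y : CrossedProduct f} (hx : NonunitAtUnits V f x)
    (hxA : x ∈ crossedProductOrder V f hf) (hy : y ∈ crossedProductOrder V f hf) :
    NonunitAtUnits V f (x * y) := by
  intro ρ W hW hρ
  refine valuation_coeff_mul_lt_one fun σ ↦ mul_lt_one_of_le_of_imp
    (valuation_le_one_of_mem_crossedProductOrder hW hxA 1 σ)
    (valuation_le_one_of_mem_crossedProductOrder hW hy _ _) (hf.valuation_le_one hW _ _)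
    fun h ↦ .inl ?_
  exact hx σ W hW (hf.unitRel_trans hW h hρ)

/-- Now `σ ≤ ρ ≤ 1 ≤ σ`, so `σ` and `ρ` are equivalent at `W`; hence `σ⁻¹ρ ≤ 1` at the conjugate
place, and the factor from `y` is a non-unit. -/
theorem NonunitAtUnits.mul_left {x y : CrossedProduct f} (hy : NonunitAtUnits V f y)
    (hx : x ∈ crossedProductOrder V f hf) (hyA : y ∈ crossedProductOrder V f hf) :
    NonunitAtUnits V f (x * y) := by
  intro ρ W hW hρ
  refine valuation_coeff_mul_lt_one fun σ ↦ mul_lt_one_of_le_of_imp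
    (valuation_le_one_of_mem_crossedProductOrder hW hx 1 σ)
    (valuation_le_one_of_mem_crossedProductOrder hW hyA _ _) (hf.valuation_le_one hW _ _)
    fun h ↦ .inr ?_
  refine (W.valuation_comap_lt_one_iff (σ : K →+* K) _).mp
    (hy _ _ (comap_mem_placesOver hW σ) ((hf.unitRel_comap_iff hW).mpr ⟨h, ?_⟩))
  exact hf.unitRel_trans hW hρ (unitRel_one σ)

/-- The Jacobson radical of the crossed-product order. -/
def crossedProductRadical : Ideal (crossedProductOrder V f hf) where
  carrier := {x | NonunitAtUnits V f x}
  zero_mem' σ W _ _ := by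
    change W.valuation ((0 : CrossedProduct f).coeff σ) < 1
    rw [coeff_zero, map_zero]; exact zero_lt_one
  add_mem' hx hy σ W hW hσ := by
    exact Valuation.map_add_lt _ (hx σ W hW hσ) (hy σ W hW hσ)
  smul_mem' a x hx := NonunitAtUnits.mul_left hf hx a.2 x.2

theorem mem_crossedProductRadical {x : crossedProductOrder V f hf} :
    x ∈ crossedProductRadical hf ↔ NonunitAtUnits V f x := Iff.rfl

instance : (crossedProductRadical hf).IsTwoSided where
  mul_mem_of_left b ha := NonunitAtUnits.mul_right hf ha (Subtype.prop _) b.2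

end Radical

/-! ### Semisimplicity of `Σ_f` and of `A_f / J`. -/

section Semisimple

variable {E K : Type*} [Field E] [Field K] [Algebra E K] [FiniteDimensional E K]
  {V : ValuationSubring E} {f : NormalizedTwoCocycle E K} {π : E}

open CrossedProduct NormalizedTwoCocycle

/-- The family of coordinates, as a linear map. -/
noncomputable def CrossedProduct.coeffLinearMap : CrossedProduct f →ₗ[E] Gal(K/E) → K where
  toFun x σ := x.coeff σ
  map_add' _ _ := rfl
  map_smul' e x := funext fun σ ↦ (coeff_smul e x σ).trans (Algebra.smul_def e _).symm

instance CrossedProduct.moduleFinite : Module.Finite E (CrossedProduct f) :=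
  Module.Finite.of_injective (coeffLinearMap (f := f)) fun _ _ h ↦
    CrossedProduct.ext fun σ ↦ congrFun h σ

/-- The Jacobson radical is homogeneous and consists of nilpotent elements, while a nonzero `a x_σ`
is invertible. -/
theorem CrossedProduct.isSemisimpleRing (hπ : IsUnramifiedUniformizer V K π) :
    IsSemisimpleRing (CrossedProduct f) := by
  have : IsArtinianRing (CrossedProduct f) := isArtinian_of_tower E inferInstance
  refine isSemisimpleRing_of_forall_jacobson fun x hx ↦ ?_
  obtain ⟨n, a, b, -, -, h1, h0⟩ := hπ.dual
  ext σ
  by_contra hne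
  rw [coeff_zero] at hne
  have hσ : single f σ (x.coeff σ) ∈ Ring.jacobson (CrossedProduct f) := by
    rw [← sum_dual_mul_mul h1 h0 x σ]
    exact sum_mem fun i _ ↦ Ideal.mul_mem_right _ _ (Ideal.mul_mem_left _ _ hx)
  have hmul : single f σ (x.coeff σ) *
      single f σ⁻¹ (σ⁻¹ ((x.coeff σ)⁻¹ * (f.val σ σ⁻¹)⁻¹)) = 1 := by
    rw [single_mul_single, mul_inv_cancel, one_def,
      show σ (σ⁻¹ ((x.coeff σ)⁻¹ * (f.val σ σ⁻¹)⁻¹)) = _ from σ.apply_symm_apply _]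
    congr 1
    have := f.val_ne_zero σ σ⁻¹
    field_simp
  have h := isNilpotent_of_mem_jacobson (Ideal.mul_mem_right
    (single f σ⁻¹ (σ⁻¹ ((x.coeff σ)⁻¹ * (f.val σ σ⁻¹)⁻¹))) _ hσ)
  rw [hmul] at h
  obtain ⟨m, hm⟩ := h
  rw [one_pow] at hm
  have := congrArg (fun y : CrossedProduct f ↦ y.coeff 1) hm
  rw [one_def] at this
  simp only [coeff_single_self, coeff_zero] at this
  exact one_ne_zero this

omit [FiniteDimensional E K] in
theorem CrossedProduct.single_one_pow (a : K) (n : ℕ) :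
    single f 1 a ^ n = single f 1 (a ^ n) := by
  induction n with
  | zero => rw [pow_zero, pow_zero, one_def]
  | succ n ih => rw [pow_succ, ih, single_mul_one_single, pow_succ]

/-- The quotient is Artinian, being finite over `V` and killed by its maximal ideal. If `y`
represents a radical element and `y_σ` is a unit at `W` with `σ ≤ 1`, isolating `y_σ x_σ` and
multiplying by `x_{σ⁻¹}` gives `c x_1` with `c` a unit at `W`; no power of it lies in `J`,
contradicting nilpotency. -/
theorem isSemisimpleRing_quotient_crossedProductRadical [IsGalois E K]
    (hπ : IsUnramifiedUniformizer V K π) (hf : f.IsIntegralOver V) :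
    IsSemisimpleRing (crossedProductOrder V f hf ⧸ crossedProductRadical hf) := by
  have hfin : Module.Finite V (crossedProductOrder V f hf) :=
    Module.Finite.iff_fg.mpr (crossedProductOrder_fg hπ hf)
  have hV : IsArtinian V (crossedProductOrder V f hf ⧸ crossedProductRadical hf) := by
    refine isArtinian_of_isTorsionBySet (IsLocalRing.maximalIdeal V) fun x v ↦ ?_
    obtain ⟨y, rfl⟩ := Ideal.Quotient.mk_surjective x
    suffices (v : V) • y ∈ crossedProductRadical hf from
      Ideal.Quotient.eq_zero_iff_mem.mpr this
    intro σ W hW hσ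
    have hv := (V.valuation_lt_one_iff v).mp v.2
    have : (((v : V) • y : crossedProductOrder V f hf) : CrossedProduct f).coeff σ =
        algebraMap E K (v : V) * (y : CrossedProduct f).coeff σ := coeff_smul _ _ _
    rw [this, map_mul]
    exact mul_lt_one_of_nonneg_of_lt_one_left zero_le
      ((valuation_algebraMap_lt_one_iff hW).mpr hv)
      (valuation_le_one_of_mem_crossedProductOrder hW y.2 1 σ)
  have : IsArtinianRing (crossedProductOrder V f hf ⧸ crossedProductRadical hf) :=
    isArtinian_of_tower V hV
  refine isSemisimpleRing_of_forall_jacobson fun x hx ↦ ?_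
  obtain ⟨y, rfl⟩ := Ideal.Quotient.mk_surjective x
  rw [Ideal.Quotient.eq_zero_iff_mem, mem_crossedProductRadical]
  intro σ W hW hσ
  by_contra hlt
  have h1 : W.valuation ((y : CrossedProduct f).coeff σ) = 1 :=
    (valuation_le_one_of_mem_crossedProductOrder hW y.2 1 σ).antisymm (not_lt.mp hlt)
  obtain ⟨n, a, b, ha, hb, hab, h0⟩ := hπ.dual
  let q := Ideal.Quotient.mk (crossedProductRadical hf)
  let c : K := (y : CrossedProduct f).coeff σ * f.val σ σ⁻¹
  have hc : W.valuation c = 1 := by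
    rw [map_mul, h1, one_mul]; exact (unitRel_one_right σ).mp hσ
  have hcS : c ∈ integralClosure V K := mul_mem (y.2 σ) (hf _ _)
  have hmem : q ⟨single f 1 c, single_mem_crossedProductOrder hf 1 hcS⟩ ∈ Ring.jacobson _ := by
    have : (⟨single f 1 c, single_mem_crossedProductOrder hf 1 hcS⟩ :
        crossedProductOrder V f hf) =
        (∑ i, (⟨single f 1 (a i), single_mem_crossedProductOrder hf 1 (ha i)⟩ :
          crossedProductOrder V f hf) * y * ⟨single f 1 (σ⁻¹ (b i)),
            single_mem_crossedProductOrder hf 1 (map_mem_integralClosure V _ (hb i))⟩) *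
          ⟨single f σ⁻¹ 1, single_mem_crossedProductOrder hf σ⁻¹ (one_mem _)⟩ := by
      refine Subtype.ext ?_
      rw [MulMemClass.coe_mul, AddSubmonoidClass.coe_finsetSum]
      change _ = (∑ i, single f 1 (a i) * (y : CrossedProduct f) * single f 1 (σ⁻¹ (b i))) *
        single f σ⁻¹ 1
      rw [sum_dual_mul_mul hab h0, single_mul_single]
      simp [c]
    rw [this, map_mul, map_sum]
    refine Ideal.mul_mem_right _ _ (sum_mem fun i _ ↦ ?_)
    rw [map_mul, map_mul]
    exact Ideal.mul_mem_right _ _ (Ideal.mul_mem_left _ _ hx)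
  obtain ⟨m, hm⟩ := isNilpotent_of_mem_jacobson hmem
  rw [← map_pow, Ideal.Quotient.eq_zero_iff_mem, mem_crossedProductRadical] at hm
  have := hm 1 W hW (unitRel_refl 1)
  rw [SubmonoidClass.coe_pow, single_one_pow, coeff_single_self, map_pow, hc, one_pow] at this
  exact lt_irrefl _ this

end Semisimple

/-! ### A power of `J` lies in `π A_f`. -/

section Nilpotent

variable {E K : Type*} [Field E] [Field K] [Algebra E K] [FiniteDimensional E K]
  {V : ValuationSubring E} {f : NormalizedTwoCocycle E K} {π : E}

open CrossedProduct NormalizedTwoCocycle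

open Classical in
/-- The elements strictly below `σ` for the preorder `UnitRel`. -/
noncomputable def NormalizedTwoCocycle.strictBelow (f : NormalizedTwoCocycle E K)
    (W : ValuationSubring K) (σ : Gal(K/E)) : Finset Gal(K/E) :=
  Finset.univ.filter fun ρ ↦ f.UnitRel W ρ σ ∧ ¬ f.UnitRel W σ ρ

theorem NormalizedTwoCocycle.IsIntegralOver.card_strictBelow_lt (hf : f.IsIntegralOver V)
    {W : ValuationSubring K} (hW : W ∈ placesOver V K) {σ τ : Gal(K/E)} (h1 : f.UnitRel W σ τ)
    (h2 : ¬ f.UnitRel W τ σ) : (f.strictBelow W σ).card < (f.strictBelow W τ).card := by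
  refine Finset.card_lt_card (Finset.ssubset_iff_of_subset (fun ρ hρ ↦ ?_) |>.mpr ⟨σ, ?_, ?_⟩)
  · simp only [strictBelow, Finset.mem_filter, Finset.mem_univ, true_and] at hρ ⊢
    exact ⟨hf.unitRel_trans hW hρ.1 h1, fun h ↦ h2 (hf.unitRel_trans hW h hρ.1)⟩
  · simp [strictBelow, h1, h2]
  · simp [strictBelow, unitRel_refl]

/-- Each factor from `J` costs a strict step in the preorder: if the term `τ` of `(z j)_σ` is a
unit, then `τ ≤ σ`, and `σ ≤ τ` is impossible because `j` would have a non-unit coordinate at the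
conjugate place. -/
theorem le_card_strictBelow_of_mem_pow (hf : f.IsIntegralOver V) {n : ℕ}
    {x : crossedProductOrder V f hf} (hx : x ∈ crossedProductRadical hf ^ n)
    {W : ValuationSubring K} (hW : W ∈ placesOver V K) (σ : Gal(K/E))
    (hσ : W.valuation ((x : CrossedProduct f).coeff σ) = 1) : n ≤ (f.strictBelow W σ).card := by
  induction n generalizing x W σ with
  | zero => exact Nat.zero_le _
  | succ n ih =>
    by_contra hlt
    refine hσ.not_lt ?_
    clear hσ
    refine Ideal.pow_succ_induction_on (p := fun x : crossedProductOrder V f hf ↦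
      W.valuation ((x : CrossedProduct f).coeff σ) < 1) hx (fun z hz j hj ↦ ?_)
      fun a b ha hb ↦ Valuation.map_add_lt _ ha hb
    have hj : NonunitAtUnits V f j := hj
    simp only [MulMemClass.coe_mul]
    refine valuation_coeff_mul_lt_one fun τ ↦ ?_
    have h1 := valuation_le_one_of_mem_crossedProductOrder hW z.2 1 τ
    refine mul_lt_one_of_le_of_imp h1
      (valuation_le_one_of_mem_crossedProductOrder hW j.2 _ _) (hf.valuation_le_one hW _ _)
      fun h ↦ ?_
    by_contra! hge
    have hz1 := ih hz hW τ (h1.antisymm hge.1)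
    by_cases hr : f.UnitRel W σ τ
    · exact hge.2.not_gt ((W.valuation_comap_lt_one_iff (τ : K →+* K) _).mp
        (hj _ _ (comap_mem_placesOver hW τ) ((hf.unitRel_comap_iff hW).mpr ⟨h, hr⟩)))
    · exact hlt (hz1.trans_lt (hf.card_strictBelow_lt hW h hr))

theorem crossedProductRadical_pow_le (hπ : IsUnramifiedUniformizer V K π)
    (hf : f.IsIntegralOver V) :
    -- The exponent exceeds the size of every set `strictBelow`, so all coordinates are non-units at
    -- all places.
    crossedProductRadical hf ^ (Fintype.card Gal(K/E) + 1) ≤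
      Ideal.span {algebraMap V (crossedProductOrder V f hf) ⟨π, hπ.mem⟩} := by
  intro x hx
  have hlt (σ : Gal(K/E)) : ∀ W ∈ placesOver V K,
      W.valuation ((x : CrossedProduct f).coeff σ) < 1 := fun W hW ↦ by
    refine (valuation_le_one_of_mem_crossedProductOrder hW x.2 1 σ).lt_of_ne fun h ↦ ?_
    have := le_card_strictBelow_of_mem_pow hf hx hW σ h
    exact (this.trans (Finset.card_le_univ _)).not_gt (Nat.lt_succ_self _)
  choose y hy hxy using fun σ ↦ hπ.exists_eq_mul (hlt σ)
  let z : crossedProductOrder V f hf := ⟨∑ σ, single f σ (y σ),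
    sum_mem fun σ _ ↦ single_mem_crossedProductOrder hf σ (hy σ)⟩
  refine Ideal.mem_span_singleton'.mpr ⟨z, ?_⟩
  rw [← Algebra.commutes]
  refine Subtype.ext (CrossedProduct.ext fun σ ↦ ?_)
  change (algebraMap E (CrossedProduct f) π * (z : CrossedProduct f)).coeff σ = _
  rw [coeff_algebraMap_mul, hxy, coeff_sum, Finset.sum_eq_single σ, coeff_single_self]
  · exact fun τ _ h ↦ coeff_single_of_ne h _
  · simp

end Nilpotent

/-! ### The criterion makes `J` projective. -/

section Projective

variable {E K : Type*} [Field E] [Field K] [Algebra E K] [FiniteDimensional E K]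
  {V : ValuationSubring E} {f : NormalizedTwoCocycle E K} {π : E}

open CrossedProduct NormalizedTwoCocycle

/-- The criterion for a crossed-product order to be hereditary: no value `f(σ, σ⁻¹)` is divisible
by the square of a maximal ideal. -/
def NormalizedTwoCocycle.SquarefreeAt (f : NormalizedTwoCocycle E K) (V : ValuationSubring E)
    (π : E) : Prop :=
  ∀ W ∈ placesOver V K, ∀ σ : Gal(K/E),
    W.valuation (algebraMap E K π) ^ 2 < W.valuation (f.val σ σ⁻¹)

-- If both relations failed, `f(σ, σ⁻¹τ) f(τ, τ⁻¹σ)` would be divisible by `π²`; it is the image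
-- under `σ` of a value to which the criterion applies at the conjugate place.
omit [FiniteDimensional E K] in
theorem NormalizedTwoCocycle.SquarefreeAt.unitRel_total (hcrit : f.SquarefreeAt V π)
    (hπ : IsUnramifiedUniformizer V K π) (hf : f.IsIntegralOver V) {W : ValuationSubring K}
    (hW : W ∈ placesOver V K) (σ τ : Gal(K/E)) : f.UnitRel W σ τ ∨ f.UnitRel W τ σ := by
  by_contra! h
  have h1 := hπ.valuation_le W hW _ ((hf.valuation_le_one hW σ (σ⁻¹ * τ)).lt_of_ne h.1)
  have h2 := hπ.valuation_le W hW _ ((hf.valuation_le_one hW τ (τ⁻¹ * σ)).lt_of_ne h.2)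
  have h3 := congrArg W.valuation (f.val_mul_inv_mul σ τ σ)
  rw [map_mul, map_mul, inv_mul_cancel σ, f.val_one_right, map_one, mul_one] at h3
  have h4 := hcrit _ (comap_mem_placesOver hW σ) (σ⁻¹ * τ)
  rw [← map_pow, ← not_le, ValuationSubring.valuation_comap_le_iff, not_le, mul_inv_rev,
    inv_inv] at h4
  have h5 : (σ : K →+* K) (algebraMap E K π ^ 2) = algebraMap E K π ^ 2 := by
    rw [map_pow]; congr 1; exact σ.commutes π
  rw [h5, map_pow] at h4
  refine h4.not_ge ?_
  change W.valuation (σ (f.val (σ⁻¹ * τ) (τ⁻¹ * σ))) ≤ _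
  rw [← h3, sq]
  exact mul_le_mul' h2 h1

/-- For each place there is a greatest element among those that are not below `1`, if any. -/
theorem NormalizedTwoCocycle.SquarefreeAt.exists_greatest (hcrit : f.SquarefreeAt V π)
    (hπ : IsUnramifiedUniformizer V K π) (hf : f.IsIntegralOver V) {W : ValuationSubring K}
    (hW : W ∈ placesOver V K) {ρ : Gal(K/E)} (hρ : ¬ f.UnitRel W ρ 1) :
    ∃ τ, ¬ f.UnitRel W τ 1 ∧ ∀ σ, ¬ f.UnitRel W σ 1 → f.UnitRel W σ τ := by
  classical
  obtain ⟨τ, hτ, hmax⟩ := Finset.exists_max_image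
    (Finset.univ.filter fun σ ↦ ¬ f.UnitRel W σ 1) (fun σ ↦ (f.strictBelow W σ).card)
    ⟨ρ, by simpa using hρ⟩
  simp only [Finset.mem_filter, Finset.mem_univ, true_and] at hτ hmax
  refine ⟨τ, hτ, fun σ hσ ↦ ?_⟩
  by_contra h
  exact (hmax σ hσ).not_gt (hf.card_strictBelow_lt hW
    ((hcrit.unitRel_total hπ hf hW σ τ).resolve_left h) h)

/-- It must be shown that `x_σ σ(b) f(σ, τ)` is a non-unit at every `W'`. Only the case where `σ`
carries `W'` to `W` matters, as `σ(b)` is a non-unit otherwise. There, if `f(σ, τ)` is a unit, then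
`σ ≤ 1` at `W'`: otherwise `σ⁻¹` is not below `1` at `W`, so `σ⁻¹ ≤ τ`, and the cocycle identity
makes `f(σ⁻¹, σ)` a unit. -/
theorem NonunitAtUnits.mul_single_div_mem (hπ : IsUnramifiedUniformizer V K π)
    (hf : f.IsIntegralOver V) {W : ValuationSubring K} {τ : Gal(K/E)}
    (hτ : ∀ σ, ¬ f.UnitRel W σ 1 → f.UnitRel W σ τ) {b : K} (hb : b ∈ integralClosure V K)
    (hbW : ∀ W' ∈ placesOver V K, W' ≠ W → W'.valuation b < 1) {x : CrossedProduct f}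
    (hx : NonunitAtUnits V f x) (hxA : x ∈ crossedProductOrder V f hf) :
    x * single f τ (b / algebraMap E K π) ∈ crossedProductOrder V f hf := by
  intro ρ
  rw [coeff_mul_single]
  generalize ρ * τ⁻¹ = σ
  have h0 : algebraMap E K π ≠ 0 := (map_ne_zero _).mpr hπ.ne_zero
  obtain ⟨y, hy, hxy⟩ := hπ.exists_eq_mul (x := x.coeff σ * σ b * f.val σ τ) fun W' hW' ↦ by
    rw [map_mul, map_mul]
    have h1 := valuation_le_one_of_mem_crossedProductOrder hW' hxA 1 σ
    have h2 := valuation_le_one_of_mem_integralClosure hW' (map_mem_integralClosure V σ hb)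
    refine mul_lt_one_of_le_of_imp h1 h2 (hf.valuation_le_one hW' _ _) fun h3 ↦ ?_
    by_cases hWW' : W'.comap (σ : K →+* K) = W
    · refine .inl (hx σ W' hW' ?_)
      subst hWW'
      by_contra hσ
      have hσ' : ¬ f.UnitRel (W'.comap (σ : K →+* K)) σ⁻¹ 1 := fun h ↦ by
        have := hf.unitRel_comap_iff hW' (σ := σ) (τ := 1)
        rw [mul_one] at this
        exact hσ (this.mp h).1
      have h4 := hτ _ hσ'
      rw [UnitRel, ValuationSubring.valuation_comap_eq_one_iff, inv_inv] at h4
      have h5 := congrArg (fun t ↦ W'.valuation (σ t)) (f.val_cocycle σ⁻¹ σ τ)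
      simp only [inv_mul_cancel, f.val_one_left, map_mul, one_mul] at h5
      rw [show σ (σ⁻¹ (f.val σ τ)) = f.val σ τ from σ.apply_symm_apply _, h3, one_mul,
        show W'.valuation (σ (f.val σ⁻¹ (σ * τ))) = 1 from h4] at h5
      refine hσ' ((unitRel_one_right _).mpr ?_)
      rw [ValuationSubring.valuation_comap_eq_one_iff, inv_inv]
      exact h5
    · exact .inr ((W'.valuation_comap_lt_one_iff (σ : K →+* K) _).mp
        (hbW _ (comap_mem_placesOver hW' σ) hWW'))
  rw [map_div₀, AlgEquiv.commutes]
  convert hy using 1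
  field_simp
  rw [hxy, mul_comm]

/-- Locally at each place, the radical is invertible. -/
theorem NormalizedTwoCocycle.SquarefreeAt.exists_mul_eq_single (hcrit : f.SquarefreeAt V π)
    (hπ : IsUnramifiedUniformizer V K π) (hf : f.IsIntegralOver V) {W : ValuationSubring K}
    (hW : W ∈ placesOver V K) :
    ∃ (y : CrossedProduct f) (j : crossedProductRadical hf), ∃ s ∈ integralClosure V K,
      W.valuation s = 1 ∧ y * (j : crossedProductOrder V f hf) = single f 1 s ∧
        ∀ x : crossedProductRadical hf,
          ((x : crossedProductOrder V f hf) : CrossedProduct f) * y ∈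
            crossedProductOrder V f hf := by
  have h0 : algebraMap E K π ≠ 0 := (map_ne_zero _).mpr hπ.ne_zero
  have hlt {W : ValuationSubring K} (hW : W ∈ placesOver V K) :=
    (valuation_algebraMap_lt_one_iff hW).mpr hπ.valuation_lt_one
  obtain ⟨b, hb, hb1, hbW⟩ := hπ.separated W hW
  -- If everything is below `1`, `J` is generated by `π` locally at `W`, with inverse `π⁻¹`.
  -- Otherwise the inverse is `π⁻¹ x_τ` with `τ` greatest among the elements not below `1`, tested
  -- against `x_{τ⁻¹}`; `b` and `c` localize at `W` and its conjugate.
  by_cases hall : ∀ ρ, f.UnitRel W ρ 1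
  · refine ⟨single f 1 (b / algebraMap E K π), ⟨⟨single f 1 (algebraMap E K π),
      single_mem_crossedProductOrder hf _ hπ.mem_integralClosure⟩, ?_⟩, b, hb, hb1, ?_, ?_⟩
    · intro σ W' hW' _
      change W'.valuation ((single f 1 (algebraMap E K π)).coeff σ) < 1
      by_cases h : 1 = σ
      · subst h
        rw [coeff_single_self]; exact hlt hW'
      · rw [coeff_single_of_ne h, map_zero]; exact zero_lt_one
    · rw [single_mul_one_single, div_mul_cancel₀ _ h0]
    · exact fun x ↦ NonunitAtUnits.mul_single_div_mem hπ hf (fun σ h ↦ (h (hall σ)).elim) hb hbW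
        x.2 x.1.2
  · obtain ⟨ρ, hρ⟩ := not_forall.mp hall
    obtain ⟨τ, hτ, hmax⟩ := hcrit.exists_greatest hπ hf hW hρ
    obtain ⟨c, hc, hc1, hcW⟩ := hπ.separated _ (comap_mem_placesOver hW τ)
    rw [ValuationSubring.valuation_comap_eq_one_iff] at hc1
    have hff : W.valuation (f.val τ τ⁻¹) < 1 :=
      (hf.valuation_le_one hW _ _).lt_of_ne fun h ↦ hτ ((unitRel_one_right τ).mpr h)
    obtain ⟨s, hs, hbs⟩ := hπ.exists_eq_mul (x := b * τ c * f.val τ τ⁻¹) fun W' hW' ↦ by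
      rw [map_mul, map_mul]
      refine mul_lt_one_of_le_of_imp (valuation_le_one_of_mem_integralClosure hW' hb)
        (valuation_le_one_of_mem_integralClosure hW' (map_mem_integralClosure V τ hc))
        (hf.valuation_le_one hW' _ _) fun h ↦ .inl (hbW W' hW' ?_)
      rintro rfl
      exact hff.ne h
    refine ⟨single f τ (b / algebraMap E K π), ⟨⟨single f τ⁻¹ c,
      single_mem_crossedProductOrder hf _ hc⟩, ?_⟩, s, hs, ?_, ?_, ?_⟩
    · intro σ W' hW' hσ
      change W'.valuation ((single f τ⁻¹ c).coeff σ) < 1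
      by_cases h : τ⁻¹ = σ
      · subst h
        rw [coeff_single_self]
        refine hcW W' hW' ?_
        rintro rfl
        have := hf.unitRel_comap_iff hW (σ := τ) (τ := 1)
        rw [mul_one] at this
        exact hτ (this.mp hσ).1
      · rw [coeff_single_of_ne h, map_zero]; exact zero_lt_one
    · have hv := congrArg W.valuation hbs
      rw [map_mul, map_mul, map_mul, hb1, show W.valuation (τ c) = 1 from hc1, one_mul,
        one_mul] at hv
      -- The criterion enters here: a non-unit `s` would make `f(τ, τ⁻¹)` divisible by `π²` at `W`.
      refine (valuation_le_one_of_mem_integralClosure hW hs).antisymm (not_lt.mp fun h ↦ ?_)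
      refine (hcrit W hW τ).not_ge ?_
      rw [hv, sq]
      exact mul_le_mul' le_rfl (hπ.valuation_le W hW s h)
    · rw [single_mul_single, mul_inv_cancel]
      congr 1
      rw [div_mul_eq_mul_div, div_mul_eq_mul_div, hbs, mul_div_cancel_left₀ _ h0]
    · exact fun x ↦ NonunitAtUnits.mul_single_div_mem hπ hf hmax hb hbW x.2 x.1.2

-- A partition of unity: with separating elements `c_W`, the sum `∑ c_W s_W` is a unit at every
-- place, hence a unit of the integral closure.
omit [FiniteDimensional E K] in
theorem IsUnramifiedUniformizer.exists_sum_mul_eq_one (hπ : IsUnramifiedUniformizer V K π)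
    [Fintype (placesOver V K)] {s : placesOver V K → K} (hs : ∀ W, s W ∈ integralClosure V K)
    (hs1 : ∀ W : placesOver V K, W.1.valuation (s W) = 1) :
    ∃ d : placesOver V K → K, (∀ W, d W ∈ integralClosure V K) ∧ ∑ W, d W * s W = 1 := by
  classical
  choose c hc hc1 hcW using fun W : placesOver V K ↦ hπ.separated W W.2
  let t : K := ∑ W, c W * s W
  have ht (W : ValuationSubring K) (hW : W ∈ placesOver V K) : W.valuation t = 1 := by
    have h1 : W.valuation (c ⟨W, hW⟩ * s ⟨W, hW⟩) = 1 := by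
      rw [map_mul, show W.valuation (c ⟨W, hW⟩) = 1 from hc1 ⟨W, hW⟩,
        show W.valuation (s ⟨W, hW⟩) = 1 from hs1 ⟨W, hW⟩, one_mul]
    have h2 : W.valuation (∑ W' ∈ Finset.univ.erase ⟨W, hW⟩, c W' * s W') < 1 :=
      Valuation.map_sum_lt _ one_ne_zero fun W' hW' ↦ by
        rw [map_mul]
        exact mul_lt_one_of_nonneg_of_lt_one_left zero_le
          (hcW W' W hW fun h ↦ (Finset.mem_erase.mp hW').1 (Subtype.ext h.symm))
          (valuation_le_one_of_mem_integralClosure hW (hs W'))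
    rw [← h1] at h2
    change W.valuation (∑ W, c W * s W) = 1
    rw [← Finset.add_sum_erase _ _ (Finset.mem_univ (⟨W, hW⟩ : placesOver V K)),
      Valuation.map_add_eq_of_lt_left _ h2, h1]
  have htS : t⁻¹ ∈ integralClosure V K :=
    mem_integralClosure_iff_forall_valuation_le_one.mpr fun W hW ↦ by
      rw [map_inv₀, ht W hW, inv_one]
  have ht0 : t ≠ 0 := by
    obtain ⟨W, hW⟩ := hπ.exists_mem_placesOver
    intro h
    have := ht W hW
    rw [h, map_zero] at this
    exact zero_ne_one this
  refine ⟨fun W ↦ t⁻¹ * c W, fun W ↦ mul_mem htS (hc W), ?_⟩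
  simp only [mul_assoc, ← Finset.mul_sum]
  exact inv_mul_cancel₀ ht0

/-- The local inverses, weighted by a partition of unity, form a dual basis of `J`. -/
theorem NormalizedTwoCocycle.SquarefreeAt.projective_radical (hcrit : f.SquarefreeAt V π)
    (hπ : IsUnramifiedUniformizer V K π) (hf : f.IsIntegralOver V) :
    Module.Projective (crossedProductOrder V f hf) (crossedProductRadical hf) := by
  choose y j s hs hs1 hys hxy using fun W : placesOver V K ↦
    hcrit.exists_mul_eq_single hπ hf W.2
  have := hπ.finite.fintype
  obtain ⟨d, hd, hds⟩ := hπ.exists_sum_mul_eq_one hs hs1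
  refine Ideal.projective_of_sum_mul_eq_one (fun W ↦ single f 1 (d W) * y W) j
    (fun W x ↦ ?_) ?_
  · have hx := hxy W ⟨x.1 * ⟨_, single_mem_crossedProductOrder hf 1 (hd W)⟩,
      Ideal.mul_mem_right _ _ x.2⟩
    rwa [MulMemClass.coe_mul, mul_assoc] at hx
  · simp only [mul_assoc, hys, single_mul_one_single]
    ext σ
    rw [coeff_sum, one_def, ← hds]
    rcases eq_or_ne 1 σ with rfl | hne
    · simp only [coeff_single_self]
    · simp only [coeff_single_of_ne hne, Finset.sum_const_zero]

end Projective

/-! ### Complements of left ideals up to a power of `π`. -/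

section Complement

/-- Take a complement of `B I` in the semisimple ring `B` and intersect it with `A`; clearing
denominators in the decomposition of `1` puts a power of `p` in the sum. -/
theorem Ideal.exists_inf_eq_bot_and_pow_mem_sup {S B : Type*} [CommRing S] [Ring B] [Algebra S B]
    [IsSemisimpleRing B] {A : Subalgebra S B} (p : S) (h : ∀ b : B, ∃ k : ℕ, p ^ k • b ∈ A)
    (I : Ideal A) : ∃ I' : Ideal A, I ⊓ I' = ⊥ ∧ ∃ k : ℕ, algebraMap S A p ^ k ∈ I ⊔ I' := by
  obtain ⟨C, hC⟩ := exists_isCompl (Ideal.span (A.val '' I))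
  have key : ∀ u ∈ Ideal.span (A.val '' I), ∃ k : ℕ, ∃ z ∈ I, (z : B) = p ^ k • u := by
    intro u hu
    induction hu using Submodule.span_induction with
    | mem x hx =>
      obtain ⟨z, hz, rfl⟩ := hx
      exact ⟨0, z, hz, by simp⟩
    | zero => exact ⟨0, 0, zero_mem _, by simp⟩
    | add x y _ _ hx hy =>
      obtain ⟨k, z, hz, e⟩ := hx
      obtain ⟨l, w, hw, e'⟩ := hy
      refine ⟨k + l, algebraMap S A p ^ l * z + algebraMap S A p ^ k * w,
        add_mem (I.mul_mem_left _ hz) (I.mul_mem_left _ hw), ?_⟩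
      change algebraMap S B p ^ l * (z : B) + algebraMap S B p ^ k * (w : B) = _
      rw [e, e', ← map_pow, ← map_pow, ← Algebra.smul_def, ← Algebra.smul_def, smul_smul,
        smul_smul, smul_add, pow_add, mul_comm (p ^ l)]
    | smul r x _ hx =>
      obtain ⟨k, z, hz, e⟩ := hx
      obtain ⟨l, hl⟩ := h r
      refine ⟨l + k, ⟨_, hl⟩ * z, I.mul_mem_left _ hz, ?_⟩
      change (p ^ l • r) * (z : B) = _
      rw [e, smul_mul_smul_comm, pow_add, smul_eq_mul]
  refine ⟨C.comap A.val, (Submodule.eq_bot_iff _).mpr fun x hx ↦ Subtype.ext ?_, ?_⟩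
  · have : (x : B) ∈ Ideal.span (A.val '' I) ⊓ C :=
      ⟨Ideal.subset_span ⟨x, hx.1, rfl⟩, hx.2⟩
    rw [hC.inf_eq_bot] at this
    exact this
  · have h1 : (1 : B) ∈ Ideal.span (A.val '' I) ⊔ C := by rw [hC.sup_eq_top]; trivial
    obtain ⟨u, hu, c, hc, huc⟩ := Submodule.mem_sup.mp h1
    obtain ⟨k, z, hz, e⟩ := key u hu
    refine ⟨k, ?_⟩
    rw [← add_sub_cancel z (algebraMap S A p ^ k)]
    refine Submodule.add_mem_sup hz ?_
    change ((algebraMap S B p) ^ k - (z : B)) ∈ C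
    rw [e, ← map_pow, Algebra.algebraMap_eq_smul_one, ← smul_sub, ← huc, add_sub_cancel_left,
      Algebra.smul_def]
    exact C.mul_mem_left _ hc

theorem Ideal.pow_mul_le_span_pow {R : Type*} [Ring R] {J : Ideal R} {p : R}
    (hp : ∀ x, p * x = x * p) {n : ℕ} (hn : n ≠ 0) (h : J ^ n ≤ Ideal.span {p}) (k : ℕ) :
    J ^ (n * k) ≤ Ideal.span {p ^ k} := by
  induction k with
  | zero => simp
  | succ k ih =>
    rcases Nat.eq_zero_or_pos k with rfl | hk
    · simpa using h
    rw [mul_add_one, Submodule.pow_add _ hn, Ideal.mul_le]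
    intro r hr s hs
    obtain ⟨a, rfl⟩ := Ideal.mem_span_singleton'.mp (ih hr)
    obtain ⟨b, rfl⟩ := Ideal.mem_span_singleton'.mp (h hs)
    refine Ideal.mem_span_singleton'.mpr ⟨a * b, ?_⟩
    have hpk : Commute (p ^ k) b := Commute.pow_left (hp b) k
    rw [pow_succ, mul_assoc a (p ^ k), ← mul_assoc (p ^ k), hpk.eq]
    simp only [mul_assoc]

end Complement

/-! ### The opposite ring and right ideals. -/

section Opposite

variable {E K : Type*} [Field E] [Field K] [Algebra E K]

open CrossedProduct MulOpposite

/-- The two-cocycle of the opposite of a crossed product. -/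
def NormalizedTwoCocycle.op (f : NormalizedTwoCocycle E K) : NormalizedTwoCocycle E K where
  toFun p := (p.1 * p.2) • f.toFun (p.2⁻¹, p.1⁻¹)
  isMulCocycle₂ σ τ ρ := by
    have h := f.isMulCocycle₂ ρ⁻¹ τ⁻¹ σ⁻¹
    have h' := congrArg ((σ * τ * ρ) • ·) h
    simp only [smul_mul', mul_smul, smul_inv_smul] at h'
    simp only [mul_inv_rev, mul_smul]
    rw [mul_comm, ← h', mul_comm]
  map_one_left σ := by simp [f.map_one_right]
  map_one_right σ := by simp [f.map_one_left]

variable {f : NormalizedTwoCocycle E K}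

theorem NormalizedTwoCocycle.val_op (σ τ : Gal(K/E)) :
    f.op.val σ τ = (σ * τ) (f.val τ⁻¹ σ⁻¹) := rfl

theorem NormalizedTwoCocycle.IsIntegralOver.op {V : ValuationSubring E}
    (hf : f.IsIntegralOver V) : f.op.IsIntegralOver V := fun σ τ ↦
  map_mem_integralClosure V (σ * τ) (hf _ _)

/-- The criterion is left-right symmetric because `f.op` and `f` agree at `(σ, σ⁻¹)`. -/
theorem NormalizedTwoCocycle.SquarefreeAt.op {V : ValuationSubring E} {π : E}
    (h : f.SquarefreeAt V π) : f.op.SquarefreeAt V π := fun W hW σ ↦ by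
  rw [val_op, mul_inv_cancel, inv_inv]
  exact h W hW σ

variable [FiniteDimensional E K]

/-- The anti-isomorphism `a x_σ ↦ σ⁻¹(a) x_{σ⁻¹}`, on the coordinates. -/
noncomputable def CrossedProduct.toOp (x : CrossedProduct f) : CrossedProduct f.op :=
  ∑ σ, single f.op σ⁻¹ (σ⁻¹ (x.coeff σ))

theorem CrossedProduct.coeff_toOp (x : CrossedProduct f) (σ : Gal(K/E)) :
    (toOp x).coeff σ = σ (x.coeff σ⁻¹) := by
  rw [toOp, coeff_sum, Finset.sum_eq_single σ⁻¹, inv_inv, coeff_single_self]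
  · exact fun τ _ h ↦ coeff_single_of_ne (fun e ↦ h (by rw [← e, inv_inv])) _
  · simp

theorem CrossedProduct.toOp_mul (x y : CrossedProduct f) : toOp (x * y) = toOp y * toOp x := by
  ext ρ
  rw [coeff_toOp, coeff_mul, coeff_mul, map_sum]
  refine Fintype.sum_equiv (Equiv.mulLeft ρ) _ _ fun σ ↦ ?_
  have h1 : (ρ * σ)⁻¹ * ρ = σ⁻¹ := by group
  have h2 : ρ * σ * σ⁻¹ = ρ := by group
  rw [Equiv.coe_mulLeft, h1, coeff_toOp, coeff_toOp, NormalizedTwoCocycle.val_op, h2, inv_inv,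
    mul_inv_rev, map_mul, map_mul]
  rw [← AlgEquiv.mul_apply (ρ * σ), h2, AlgEquiv.mul_apply]
  ring

theorem CrossedProduct.toOp_add (x y : CrossedProduct f) : toOp (x + y) = toOp x + toOp y := by
  ext ρ
  simp only [coeff_toOp, coeff_add, map_add]

theorem CrossedProduct.toOp_injective : Function.Injective (toOp (f := f)) := fun x y h ↦ by
  ext σ
  have := congrArg (fun z ↦ z.coeff σ⁻¹) h
  simp only [coeff_toOp, inv_inv] at this
  exact (σ⁻¹).injective this

variable {V : ValuationSubring E}

theorem CrossedProduct.toOp_mem (hf : f.IsIntegralOver V) {x : CrossedProduct f}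
    (hx : x ∈ crossedProductOrder V f hf) : toOp x ∈ crossedProductOrder V f.op hf.op := fun σ ↦ by
  rw [coeff_toOp]
  exact map_mem_integralClosure V σ (hx _)

theorem CrossedProduct.exists_toOp_eq (hf : f.IsIntegralOver V) {z : CrossedProduct f.op}
    (hz : z ∈ crossedProductOrder V f.op hf.op) : ∃ x ∈ crossedProductOrder V f hf, toOp x = z := by
  refine ⟨∑ σ, single f σ (σ (z.coeff σ⁻¹)), sum_mem fun σ _ ↦
    single_mem_crossedProductOrder hf σ (map_mem_integralClosure V σ (hz _)), ?_⟩
  ext τ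
  rw [coeff_toOp, coeff_sum, Finset.sum_eq_single τ⁻¹, coeff_single_self, inv_inv]
  · exact τ.apply_symm_apply _
  · exact fun σ _ h ↦ coeff_single_of_ne h _
  · simp

/-- The opposite of a crossed-product order is a crossed-product order. -/
noncomputable def crossedProductOrderOp (hf : f.IsIntegralOver V) :
    (crossedProductOrder V f hf)ᵐᵒᵖ ≃+* crossedProductOrder V f.op hf.op :=
  RingEquiv.mk (Equiv.ofBijective (fun x ↦ ⟨toOp x.unop.1, toOp_mem hf x.unop.2⟩)
    ⟨fun x y h ↦ unop_injective (Subtype.ext (toOp_injective (congrArg Subtype.val h))),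
      fun z ↦ by
        obtain ⟨x, hx, e⟩ := exists_toOp_eq hf z.2
        exact ⟨op ⟨x, hx⟩, Subtype.ext e⟩⟩)
    (fun x y ↦ Subtype.ext (toOp_mul y.unop.1 x.unop.1))
    (fun x y ↦ Subtype.ext (toOp_add x.unop.1 y.unop.1))

theorem projective_submodule_mulOpposite {A B : Type*} [Ring A] [Ring B] (e : Aᵐᵒᵖ ≃+* B)
    (h : ∀ I : Submodule B B, Module.Projective B I) (I : Submodule Aᵐᵒᵖ A) :
    Module.Projective Aᵐᵒᵖ I := by
  have := RingHomInvPair.of_ringEquiv e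
  have := RingHomInvPair.symm (e : Aᵐᵒᵖ →+* B) (e.symm : B →+* Aᵐᵒᵖ)
  let ψ : A ≃ₛₗ[(e : Aᵐᵒᵖ →+* B)] B :=
    { (opAddEquiv (α := A)).trans e.toAddEquiv with
      map_smul' := fun r a ↦ by
        change e (op (a * r.unop)) = e r * e (op a)
        rw [← map_mul]
        rfl }
  have := h (I.map ψ.toLinearMap)
  exact Module.Projective.of_equiv (ψ.submoduleMap I).symm

end Opposite

/-! ### The criterion and the theorem. -/

section Hereditary

variable {E K : Type*} [Field E] [Field K] [Algebra E K] [FiniteDimensional E K] [IsGalois E K]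
  {V : ValuationSubring E} {f : NormalizedTwoCocycle E K} {π : E}

open CrossedProduct

/-- Some `π^k` lies in `I ⊕ I'`, and a power of `J` lies in `π^k A_f`, so `I` is a summand of a
projective ideal. -/
theorem NormalizedTwoCocycle.SquarefreeAt.projective (hcrit : f.SquarefreeAt V π)
    (hπ : IsUnramifiedUniformizer V K π) (hf : f.IsIntegralOver V)
    (I : Ideal (crossedProductOrder V f hf)) : Module.Projective (crossedProductOrder V f hf) I := by
  classical
  have := CrossedProduct.isSemisimpleRing (f := f) hπ
  have := isSemisimpleRing_quotient_crossedProductRadical hπ hf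
  have := hcrit.projective_radical hπ hf
  obtain ⟨I', hI, k, hk⟩ := Ideal.exists_inf_eq_bot_and_pow_mem_sup (⟨π, hπ.mem⟩ : V) (fun b ↦ by
    choose k hk using fun σ ↦ hπ.exists_pow_mul_mem (b.coeff σ)
    -- A common exponent clearing the denominators of all coordinates.
    refine ⟨∑ σ, k σ, fun σ ↦ ?_⟩
    change (π ^ (∑ σ, k σ) • b).coeff σ ∈ _
    rw [coeff_smul, ← Finset.sum_erase_add _ _ (Finset.mem_univ σ), pow_add, map_mul, mul_assoc,
      map_pow, map_pow]
    exact mul_mem (pow_mem hπ.mem_integralClosure _) (hk σ)) I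
  refine Ideal.projective_of_inf_eq_bot (crossedProductRadical hf) hI
    ((Ideal.pow_mul_le_span_pow (fun x ↦ Algebra.commutes _ x) (Nat.succ_ne_zero _)
      (crossedProductRadical_pow_le hπ hf) k).trans ?_)
  rwa [Ideal.span_le, Set.singleton_subset_iff]

theorem NormalizedTwoCocycle.SquarefreeAt.isHereditaryOrderIn (hcrit : f.SquarefreeAt V π)
    (hπ : IsUnramifiedUniformizer V K π) (hf : f.IsIntegralOver V) :
    IsHereditaryOrderIn V (crossedProductOrder V f hf) :=
  ⟨isOrderIn_crossedProductOrder hπ hf, hcrit.projective hπ hf,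
    projective_submodule_mulOpposite (crossedProductOrderOp hf) (hcrit.op.projective hπ hf.op)⟩

omit [IsGalois E K] in
theorem NormalizedTwoCocycle.squarefreeAt_of_isHereditaryRing
    (hπ : IsUnramifiedUniformizer V K π) (hf : f.IsIntegralOver V)
    (hA : IsHereditaryRing (crossedProductOrder V f hf)) : f.SquarefreeAt V π := fun W hW σ ↦ by
  have := lt_valuation_val_inv_of_projective hπ hf hA.1 hW σ⁻¹
  rwa [inv_inv] at this

-- The same inequalities, required for fewer places and fewer group elements.
omit [FiniteDimensional E K] [IsGalois E K] in
theorem NormalizedTwoCocycle.SquarefreeAt.restrict (hcrit : f.SquarefreeAt V π)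
    {L : IntermediateField E K} {U : ValuationSubring L}
    (hU : U.comap (algebraMap E L) = V) : (f.restrict L).SquarefreeAt U (algebraMap E L π) :=
  fun W hW σ ↦ hcrit W (mem_placesOver_of_tower hU hW) (σ.restrictScalars E)

end Hereditary

theorem corollary4 {F K : Type*} [Field F] [Field K] [Algebra F K] [FiniteDimensional F K]
    [IsGalois F K] (V : ValuationSubring F) [IsDiscreteValuationRing V]
    [Algebra.FormallyUnramified V (integralClosure V K)]
    (f : NormalizedTwoCocycle F K) (hf : f.IsIntegralOver V)
    (hA : IsHereditaryRing (crossedProductOrder V f hf)) :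
    ∀ (L : IntermediateField F K) (U : ValuationSubring L)
      (hU : U.comap (algebraMap F L) = V),
      IsHereditaryOrderIn U (crossedProductOrder U (f.restrict L) (hf.restrict hU)) := by
  intro L U hU
  obtain ⟨π, hπ⟩ := IsDiscreteValuationRing.exists_irreducible V
  have h := isUnramifiedUniformizer (K := K) hπ
  exact ((NormalizedTwoCocycle.squarefreeAt_of_isHereditaryRing h hf hA).restrict hU)
    |>.isHereditaryOrderIn (h.tower hU) (hf.restrict hU)
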